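/- Let $(\Omega,\mathcal T,\mathbb P)$ be a probability space with a filtration $(\mathcal T_n)_{n\ge 1}$, let $\mathcal D\subseteq\mathbb R$ and $\psi:\mathcal D\to\mathbb R$, and let $(\Theta_n)_{n\ge1}$ be an adapted real-valued process with $\Theta_n\in\mathcal D$ and $$\Theta_{n+1}=\Theta_n-\frac1{n+1}\bigl(\psi(\Theta_n)+\epsilon_{n+1}\bigr),\qquad n\ge 1,$$ almost surely, where $(\epsilon_n)_{n\ge2}$ is adapted. Assume: 1. There is $\theta_0\in\mathcal D$ such that $\psi(\theta_0)=0$, $\Theta_n\to\theta_0$ almost surely, $\mathcal D$ is an interval near $\theta_0$ (that is, $\mathcal D\cap U$ is an interval for some neighbourhood $U$ of $\theta_0$), $\psi$ is differentiable at $\theta_0$ and $\psi'(\theta_0)>0$. (Derivatives of $\psi$ are taken within $\mathcal D$; they are the ordinary ones if $\theta_0$ is interior to $\mathcal D$.) 2. $(\epsilon_n,\mathcal T_n)_{n\ge2}$ is a square-integrable martingale-difference sequence, i.e. $\mathbb E(\epsilon_{n+1}\mid\mathcal T_n)=0$ for $n\ge1$; for some $s>0$, $\lim_n\mathbb E(\epsilon_{n+1}^2\mid\mathcal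 T_n)=s^2$ almost surely; and for some $\beta>0$, $\sup_{n\ge1}\mathbb E(|\epsilon_{n+1}|^{2+\beta}\mid\mathcal T_n)<\infty$ almost surely. 3. $k\ge1$ and $\psi$ is $k$ times differentiable at $\theta_0$ (its derivatives of order $<k$ exist near $\theta_0$ and that of order $k$ exists at $\theta_0$). If $k=1$, assume in addition that for some $\delta>0$, $\psi(\theta)=\psi(\theta_0)+\psi'(\theta_0)(\theta-\theta_0)+o(|\theta-\theta_0|^{1+\delta})$ as $\theta\to\theta_0$. Let $b_1=1$ and, for $t\ge2$, $$b_t=\frac1{\psi'(\theta_0)(t-1)}\sum_{i=2}^t\frac{\psi^{(i)}(\theta_0)}{i!}\sum_{(c_1,\dots,c_i)\in\mathcal P_{i,t}}\nu_{(c_1,\dots,c_i)}\,b_{c_1}\cdots b_{c_i},$$ where $\mathcal P_{i,t}$ is the set of integer tuples $1\le c_1\le\dots\le c_i$ with $c_1+\dots+c_i=t$ and $\nu_{(c_1,\dots,c_i)}$ is the number of distinct arrangements of $(c_1,\dots,c_i)$. Put $R(\theta)=\psi(\theta_0+\theta)-\psi'(\theta_0)\theta$. If $\psi'(\theta_0)<\frac12$,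 then there is a finite random variable $Z$ with $n^{\psi'(\theta_0)}(\Theta_n-\theta_0)\to Z$ almost surely, and the following hold. (a) If $k>1$ and $0<\psi'(\theta_0)<\frac1{2(k-1)}$, then almost surely, for every real sequence $r_j=O(1/j)$, the series $$A_n=\sum_{j=n}^\infty\frac{1}{(j+1)^{1-\psi'(\theta_0)}}\,(1+r_j)\,R(\Theta_j-\theta_0)$$ converges absolutely, and as $n\to\infty$, $$n^{(k-1)\psi'(\theta_0)}A_n=\sum_{t=2}^k n^{(k-t)\psi'(\theta_0)}\,b_t\,Z^t+o(1).$$ (b) If $k\ge1$ and $0<\psi'(\theta_0)<\frac1{2k}$, then almost surely, as $n\to\infty$, $$\Theta_n-\theta_0=\sum_{j=1}^k b_j\Bigl(\frac{Z}{n^{\psi'(\theta_0)}}\Bigr)^j+o\bigl(n^{-k\psi'(\theta_0)}\bigr).$$ -/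

import Mathlib

open MeasureTheory ProbabilityTheory Filter Topology Asymptotics

/-- `partitionSeqs i t` is the finite set `𝒫_{i,t}` of all `(c₁, …, c_i)` of natural numbers with
`1 ≤ c₁ ≤ ⋯ ≤ c_i` and `c₁ + ⋯ + c_i = t`. -/
def partitionSeqs (i t : ℕ) : Finset (Fin i → ℕ) :=
  (Finset.piAntidiag Finset.univ t).filter (fun c => (∀ j, 1 ≤ c j) ∧ Monotone c)

/-- `arrangements c` is the number `ν_c` of distinct arrangements of the tuple `c`. -/
def arrangements {i : ℕ} (c : Fin i → ℕ) : ℕ :=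
  (Finset.univ.image (fun σ : Equiv.Perm (Fin i) => c ∘ σ)).card

theorem mem_partitionSeqs {i t : ℕ} {c : Fin i → ℕ} :
    c ∈ partitionSeqs i t ↔ (∑ j, c j = t) ∧ (∀ j, 1 ≤ c j) ∧ Monotone c := by
  simp [partitionSeqs]

theorem lt_of_mem_partitionSeqs {i t : ℕ} (hi : 2 ≤ i) {c : Fin i → ℕ}
    (hc : c ∈ partitionSeqs i t) (j : Fin i) : c j < t := by
  obtain ⟨hsum, hpos, -⟩ := mem_partitionSeqs.1 hc
  have : Nontrivial (Fin i) := Fin.nontrivial_iff_two_le.2 hi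
  obtain ⟨l, hl⟩ := exists_ne j
  have h : ∑ m ∈ ({l, j} : Finset (Fin i)), c m ≤ ∑ m, c m :=
    Finset.sum_le_sum_of_subset (Finset.subset_univ _)
  rw [Finset.sum_pair hl, hsum] at h
  have := hpos l
  omega

/-- The coefficients `b_t` of the expansion, defined recursively from the numbers
`d i` (to be the derivatives `ψ⁽ⁱ⁾(θ₀)`):
`b₁ = 1` and, for `t ≥ 2`,
`b_t = 1 / (d₁ (t - 1)) * ∑_{i=2}^t d_i / i! * ∑_{c ∈ 𝒫_{i,t}} ν_c b_{c₁} ⋯ b_{c_i}`.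
The value at `t = 0` is irrelevant (it is `0`). -/
noncomputable def expansionCoeff (d : ℕ → ℝ) (t : ℕ) : ℝ :=
  if t = 1 then 1 else
    1 / (d 1 * ((t : ℝ) - 1)) *
      ∑ i : Finset.Icc 2 t, d i / (Nat.factorial i : ℝ) *
        ∑ c : partitionSeqs i t, (arrangements c.1 : ℝ) * ∏ j, expansionCoeff d (c.1 j)
termination_by t
decreasing_by exact lt_of_mem_partitionSeqs (Finset.mem_Icc.1 i.2).1 c.2 j

theorem expansionCoeff_one (d : ℕ → ℝ) : expansionCoeff d 1 = 1 := by
  rw [expansionCoeff]; simp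

/-- The defining recursion of the coefficients. -/
theorem expansionCoeff_recursion (d : ℕ → ℝ) {t : ℕ} (ht : 2 ≤ t) :
    expansionCoeff d t = 1 / (d 1 * ((t : ℝ) - 1)) *
      ∑ i ∈ Finset.Icc 2 t, d i / (Nat.factorial i : ℝ) *
        ∑ c ∈ partitionSeqs i t, (arrangements c : ℝ) * ∏ j, expansionCoeff d (c j) := by
  rw [expansionCoeff, if_neg (by omega)]
  congr 1
  rw [← Finset.sum_coe_sort (Finset.Icc 2 t)]
  refine Finset.sum_congr rfl fun i _ => ?_
  congr 1
  exact Finset.sum_coe_sort (partitionSeqs i t)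
    (fun c => (arrangements c : ℝ) * ∏ j, expansionCoeff d (c j))

/-- `f`, viewed as a function on `s` only, is `k` times differentiable at `x`: the derivatives of
order `< k` exist on a neighbourhood of `x` in `s`, and the one of order `k` exists at `x`.
All derivatives are taken within `s` (so they are the ordinary ones if `x` is interior to `s` and
one-sided ones if `x` is an endpoint of an interval `s`). -/
def TimesDifferentiableWithinAt (k : ℕ) (f : ℝ → ℝ) (s : Set ℝ) (x : ℝ) : Prop :=
  (∀ i, i + 1 < k → ∀ᶠ y in 𝓝[s] x, DifferentiableWithinAt ℝ (iteratedDerivWithin i f s) s y) ∧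
  ∀ i, i < k → DifferentiableWithinAt ℝ (iteratedDerivWithin i f s) s x

/-- A one-dimensional stochastic approximation process `(Θ_n, 𝒯_n)_{n ≥ 1}` on `𝒟` with drift
`ψ : 𝒟 → ℝ` (only the values of `ψ` on `𝒟` matter), step sizes `(a_n)_{n ≥ 1}` and noise
`(ε_n)_{n ≥ 2}`. -/
structure IsStochasticApproximation {Ω : Type*} {mΩ : MeasurableSpace Ω} (μ : Measure Ω)
    (𝒯 : Filtration ℕ mΩ) (𝒟 : Set ℝ) (ψ : ℝ → ℝ) (a : ℕ → ℝ) (Θ ε : ℕ → Ω → ℝ) : Prop where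
  step_pos : ∀ n, 1 ≤ n → 0 < a n
  adapted : ∀ n, 1 ≤ n → Measurable[𝒯 n] (Θ n)
  noise_adapted : ∀ n, 2 ≤ n → Measurable[𝒯 n] (ε n)
  mem_domain : ∀ᵐ ω ∂μ, ∀ n, 1 ≤ n → Θ n ω ∈ 𝒟
  recurrence : ∀ᵐ ω ∂μ, ∀ n, 1 ≤ n → Θ (n + 1) ω = Θ n ω - a n * (ψ (Θ n ω) + ε (n + 1) ω)

/-- The assumptions on the noise: `(ε_n, 𝒯_n)_{n ≥ 2}` is a square integrable
martingale-difference sequence, `E(ε_{n+1}² | 𝒯_n) → s²` almost surely for some `s > 0`, and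
`sup_{n ≥ 1} E(|ε_{n+1}|^{2+β} | 𝒯_n) < ∞` almost surely for some `β > 0`. The last conditional
expectation is that of a `[0, ∞]`-valued function, so that no integrability is presupposed. -/
structure IsRegularNoise {Ω : Type*} {mΩ : MeasurableSpace Ω} (μ : Measure Ω)
    (𝒯 : Filtration ℕ mΩ) (ε : ℕ → Ω → ℝ) : Prop where
  adapted : ∀ n, 2 ≤ n → Measurable[𝒯 n] (ε n)
  memLp : ∀ n, 2 ≤ n → MemLp (ε n) 2 μ
  martingale_difference : ∀ n, 1 ≤ n → μ[ε (n + 1) | 𝒯 n] =ᵐ[μ] 0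
  variance_tendsto : ∃ s : ℝ, 0 < s ∧
    ∀ᵐ ω ∂μ, Tendsto (fun n => (μ[fun ω' => ε (n + 1) ω' ^ 2 | 𝒯 n]) ω) atTop (𝓝 (s ^ 2))
  moment_bound : ∃ β : ℝ, 0 < β ∧
    ∀ᵐ ω ∂μ, (⨆ (n : ℕ) (_ : 1 ≤ n),
      condLExp (𝒯 n) μ (fun ω' => ENNReal.ofReal (|ε (n + 1) ω'| ^ (2 + β))) ω) < ⊤

/-- The remainder `R(θ) = ψ(θ₀ + θ) - ψ'(θ₀) θ` of the linearisation of `ψ` at its zero `θ₀`. -/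
noncomputable def linearRemainder (ψ : ℝ → ℝ) (𝒟 : Set ℝ) (θ₀ θ : ℝ) : ℝ :=
  ψ (θ₀ + θ) - derivWithin ψ 𝒟 θ₀ * θ

/-- The `j`-th term `(j+1)^{-(1-ψ'(θ₀))} (1 + r_j) R(x_j - θ₀)` of the series `A_n` along the
sequence `x`; here `r_j` is the term written `O(1/j)`. -/
noncomputable def tailTerm (ψ : ℝ → ℝ) (𝒟 : Set ℝ) (θ₀ : ℝ) (r x : ℕ → ℝ) (j : ℕ) : ℝ :=
  1 / ((j : ℝ) + 1) ^ (1 - derivWithin ψ 𝒟 θ₀) * (1 + r j) * linearRemainder ψ 𝒟 θ₀ (x j - θ₀)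

/-- The tail sum `A_n = ∑_{j ≥ n} (j+1)^{-(1-ψ'(θ₀))} (1 + r_j) R(x_j - θ₀)`. -/
noncomputable def tailSum (ψ : ℝ → ℝ) (𝒟 : Set ℝ) (θ₀ : ℝ) (r x : ℕ → ℝ) (n : ℕ) : ℝ :=
  ∑' j, tailTerm ψ 𝒟 θ₀ r x (n + j)

/-! Write `γ = ψ'(θ₀)` and `x n = Θ n - θ₀`. The process solves a linear recursion with factor `1 -
γ / (n + 1)`, perturbed by `R (x n)` and by the noise. Up to a relative error `O(n⁻²)`, `n ^ γ` is
an integrating factor: `n ^ γ * x n` has increments `-(n + 1) ^ (γ - 1) * (R (x n) + ε (n + 1))`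
plus a small term. Since `γ < 1/2`, the weights `(n + 1) ^ (γ - 1)` are square summable, so the
weighted noise series converges almost surely; Abel summation shows that its tail `N n` is `o(n ^
(-ρ))` for every `ρ < 1/2 - γ` (`IsRegularNoise.exists_tail`). From there on, everything is
deterministic along a fixed path.

Subtracting `N n` removes the noise from the increments. If the perturbation is `o(x)`, a Gronwall
argument gives `x = O(n ^ (η - γ))` for each small `η > 0`. Inserting this into `R = O(|x| ^ (1 +
δ))` makes the increments summable, which produces `Z` (`exists_tendsto_rescaled`).

The `b_t` come from the noiseless equation `θ' = -ψ(θ₀ + θ) / n` with ansatz `θ = B(z) = ∑ b_j z ^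
j`, `z = Z n ^ (-γ)`. As `dz/dn = -γ z / n`, comparing coefficients of `z ^ t` gives `γ (t - 1) b_t
= [z ^ t] R(B(z))`, which is the recursion. The expansion is then bootstrapped. Since `R` starts at
degree two, order `m` for `x` yields order `m + 1` for `R` (`sum_pow_expansion`). The error `x - B`
then solves the linear recursion with a perturbation `o(n ^ (-(m + 1) γ))`, which improves `x` to
order `m + 1` as long as `N = o(n ^ (-m γ))`, that is, for `(m + 1) γ < 1/2` (`expansion_succ`). For
(a), order `k - 1` for `x` suffices, whence the weaker condition on `γ`; summing the expansion of
`R` divides each coefficient by `γ (t - 1)` (`tsum_tail_expansion`). -/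

/-! ### Almost sure convergence of martingale series -/

/-- A series of square-integrable martingale differences with summable variances converges
almost surely. -/
theorem exists_tendsto_sum_of_summable_variance {Ω : Type*} {mΩ : MeasurableSpace Ω}
    (μ : Measure Ω) [IsProbabilityMeasure μ] (ℱ : Filtration ℕ mΩ) (ξ : ℕ → Ω → ℝ)
    (hmeas : ∀ n, StronglyMeasurable[ℱ (n + 1)] (ξ n)) (hL2 : ∀ n, MemLp (ξ n) 2 μ)
    (hmd : ∀ n, μ[ξ n | ℱ n] =ᵐ[μ] 0) (hsum : Summable fun n => ∫ ω, ξ n ω ^ 2 ∂μ) :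
    ∀ᵐ ω ∂μ, ∃ l, Tendsto (fun n => ∑ j ∈ Finset.range n, ξ j ω) atTop (𝓝 l) := by
  set M : ℕ → Ω → ℝ := fun n ω => ∑ j ∈ Finset.range n, ξ j ω with hM
  have hMsucc : ∀ n, M (n + 1) = M n + ξ n := fun n => by
    ext ω; simp [hM, Finset.sum_range_succ]
  have hMadp : ∀ n, StronglyMeasurable[ℱ n] (M n) := by
    intro n
    refine Finset.stronglyMeasurable_fun_sum _ fun j hj => ?_
    exact (hmeas j).mono (ℱ.mono (Finset.mem_range.1 hj))
  have hML2 : ∀ n, MemLp (M n) 2 μ := fun n => memLp_finsetSum _ fun j _ => hL2 j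
  have hMint : ∀ n, Integrable (M n) μ := fun n => (hML2 n).integrable one_le_two
  have hmart : Martingale M ℱ μ := by
    refine martingale_of_condExp_sub_eq_zero_nat hMadp hMint fun n => ?_
    rw [hMsucc, add_sub_cancel_left]
    exact hmd n
  -- Orthogonality of the increments: `M n` is known at time `n`, so it comes out of the conditional
  -- expectation.
  have hcross : ∀ n, ∫ ω, M n ω * ξ n ω ∂μ = 0 := by
    intro n
    have hi : Integrable (M n * ξ n) μ := (hML2 n).integrable_mul (hL2 n)
    have h := condExp_mul_of_stronglyMeasurable_left (hMadp n) hi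
      ((hL2 n).integrable one_le_two)
    have h0 : μ[M n * ξ n | ℱ n] =ᵐ[μ] 0 := by
      filter_upwards [h, hmd n] with ω h1 h2
      simp [h1, h2]
    have h3 := integral_condExp (μ := μ) (f := M n * ξ n) (ℱ.le n)
    rw [integral_congr_ae h0] at h3
    simpa using h3.symm
  have hsq : ∀ n, ∫ ω, M n ω ^ 2 ∂μ = ∑ j ∈ Finset.range n, ∫ ω, ξ j ω ^ 2 ∂μ := by
    intro n
    induction n with
    | zero => simp [hM]
    | succ n ih =>
      rw [Finset.sum_range_succ, ← ih, hMsucc]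
      have e : (fun ω => (M n + ξ n) ω ^ 2)
          = fun ω => (M n ω ^ 2 + 2 * (M n ω * ξ n ω)) + ξ n ω ^ 2 := by
        ext ω; simp only [Pi.add_apply]; ring
      have i1 : Integrable (fun ω => M n ω ^ 2) μ := (hML2 n).integrable_sq
      have i2 : Integrable (fun ω => 2 * (M n ω * ξ n ω)) μ :=
        ((hML2 n).integrable_mul (hL2 n)).const_mul 2
      have i3 : Integrable (fun ω => M n ω ^ 2 + 2 * (M n ω * ξ n ω)) μ := i1.add i2
      rw [e, integral_add i3 (hL2 n).integrable_sq, integral_add i1 i2,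
        integral_const_mul, hcross]
      ring
  set S := ∑' n, ∫ ω, ξ n ω ^ 2 ∂μ with hS
  -- An `L¹` bound, from `|M| ≤ M² + 1`, is what the martingale convergence theorem needs.
  have hbd : ∀ n, eLpNorm (M n) 1 μ ≤ ((S + 1).toNNReal : ENNReal) := by
    intro n
    rw [eLpNorm_one_eq_lintegral_enorm, ← ofReal_integral_norm_eq_lintegral_enorm (hMint n)]
    refine ENNReal.ofReal_le_ofReal ?_
    have h1 : ∫ ω, ‖M n ω‖ ∂μ ≤ ∫ ω, (M n ω ^ 2 + 1) ∂μ := by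
      refine integral_mono (hMint n).norm ((hML2 n).integrable_sq.add (integrable_const 1)) ?_
      intro ω
      simp only [Real.norm_eq_abs]
      nlinarith [sq_nonneg (|M n ω| - 1), sq_abs (M n ω), abs_nonneg (M n ω)]
    rw [integral_add (hML2 n).integrable_sq (integrable_const 1), hsq] at h1
    have h2 := hsum.sum_le_tsum (Finset.range n) fun j _ =>
      integral_nonneg fun ω => sq_nonneg (ξ j ω)
    have h3 : ∫ _, (1 : ℝ) ∂μ = 1 := by simp
    linarith
  exact hmart.submartingale.exists_ae_tendsto_of_bdd hbd

/-- A weighted series of martingale differences with convergent conditional variances and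
square-summable weights converges almost surely. -/
theorem exists_tendsto_sum_of_condVar_tendsto {Ω : Type*} {mΩ : MeasurableSpace Ω}
    (μ : Measure Ω) [IsProbabilityMeasure μ] (ℱ : Filtration ℕ mΩ) (ξ : ℕ → Ω → ℝ) (c : ℕ → ℝ)
    (s : ℝ) (hmeas : ∀ n, StronglyMeasurable[ℱ (n + 1)] (ξ n)) (hL2 : ∀ n, MemLp (ξ n) 2 μ)
    (hmd : ∀ n, μ[ξ n | ℱ n] =ᵐ[μ] 0)
    (hvar : ∀ᵐ ω ∂μ, Tendsto (fun n => (μ[fun ω' => ξ n ω' ^ 2 | ℱ n]) ω) atTop (𝓝 s))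
    (hc : Summable fun n => c n ^ 2) :
    ∀ᵐ ω ∂μ, ∃ l, Tendsto (fun n => ∑ j ∈ Finset.range n, c j * ξ j ω) atTop (𝓝 l) := by
  set V : ℕ → Ω → ℝ := fun n => μ[fun ω' => ξ n ω' ^ 2 | ℱ n] with hV
  have hVm : ∀ n, StronglyMeasurable[ℱ n] (V n) := fun n => stronglyMeasurable_condExp
  -- Localisation: the event `A K n` is known at time `n`, so restricting to it keeps the
  -- martingale-difference property and bounds the variance by `K * c n ^ 2`.
  set A : ℕ → ℕ → Set Ω := fun K n => {ω | V n ω ≤ K} with hA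
  have hAm : ∀ K n, MeasurableSet[ℱ n] (A K n) := fun K n =>
    measurableSet_le (hVm n).measurable measurable_const
  have key : ∀ K : ℕ, ∀ᵐ ω ∂μ, ∃ l, Tendsto
      (fun n => ∑ j ∈ Finset.range n, (A K j).indicator (fun ω => c j * ξ j ω) ω) atTop (𝓝 l) := by
    intro K
    refine exists_tendsto_sum_of_summable_variance μ ℱ
      (fun j => (A K j).indicator (fun ω => c j * ξ j ω)) ?_ ?_ ?_ ?_
    · intro n
      exact ((hmeas n).const_mul (c n)).indicator (ℱ.mono n.le_succ _ (hAm K n))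
    · intro n
      exact ((hL2 n).const_mul (c n)).indicator (ℱ.le n _ (hAm K n))
    · intro n
      have h1 := condExp_indicator (((hL2 n).const_mul (c n)).integrable one_le_two) (hAm K n)
      have h2 := condExp_smul (μ := μ) (c n) (ξ n) (ℱ n)
      filter_upwards [h1, h2, hmd n] with ω h1 h2 h3
      have h4 : (μ[fun ω => c n * ξ n ω | ℱ n]) ω = 0 := by
        have : (fun ω => c n * ξ n ω) = c n • ξ n := rfl
        rw [this, h2]; simp [h3]
      rw [h1, Set.indicator_apply, h4]; simp
    · refine Summable.of_nonneg_of_le (fun n => integral_nonneg fun ω => sq_nonneg _)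
        (fun n => ?_) (hc.mul_right (K : ℝ))
      have e : ∀ ω, (A K n).indicator (fun ω => c n * ξ n ω) ω ^ 2
          = c n ^ 2 * (A K n).indicator (fun ω => ξ n ω ^ 2) ω := by
        intro ω
        by_cases h : ω ∈ A K n <;> simp [h, mul_pow]
      simp_rw [e]
      rw [integral_const_mul]
      refine mul_le_mul_of_nonneg_left ?_ (sq_nonneg _)
      have hi := (hL2 n).integrable_sq
      have h1 := condExp_indicator hi (hAm K n)
      rw [← integral_condExp (ℱ.le n), integral_congr_ae h1]
      calc ∫ ω, (A K n).indicator (V n) ω ∂μ ≤ ∫ _, (K : ℝ) ∂μ := by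
            refine integral_mono (integrable_condExp.indicator (ℱ.le n _ (hAm K n)))
              (integrable_const _) fun ω => ?_
            by_cases h : ω ∈ A K n
            · rw [Set.indicator_of_mem h]; exact h
            · simp [h]
        _ = K := by simp
  filter_upwards [ae_all_iff.2 key, hvar] with ω h1 h2
  -- On this path the conditional variances are bounded, so for large `K` the truncation is never
  -- active.
  obtain ⟨b, hb⟩ := h2.bddAbove_range
  obtain ⟨K, hK⟩ := exists_nat_ge b
  obtain ⟨l, hl⟩ := h1 K
  refine ⟨l, hl.congr fun n => Finset.sum_congr rfl fun j _ => ?_⟩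
  have : ω ∈ A K j := (hb ⟨j, rfl⟩).trans hK
  simp [this]

/-- Abel summation: if `∑ a_j` converges and `ρ_j ↓ 0` is positive, then the tails of
`∑ ρ_j a_j` are `o(ρ_n)`. -/
theorem exists_tail_isLittleO {a ρ : ℕ → ℝ} {l : ℝ}
    (ha : Tendsto (fun n => ∑ j ∈ Finset.range n, a j) atTop (𝓝 l)) (hρ : ∀ n, 0 < ρ n)
    (hanti : Antitone ρ) :
    ∃ N : ℕ → ℝ, (∀ n, N (n + 1) = N n - ρ n * a n) ∧ N =o[atTop] ρ := by
  set τ : ℕ → ℝ := fun n => l - ∑ j ∈ Finset.range n, a j with hτ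
  have hτ0 : Tendsto τ atTop (𝓝 0) := by simpa using ha.const_sub l
  have haτ : ∀ n, a n = τ n - τ (n + 1) := fun n => by
    simp [hτ, Finset.sum_range_succ]
  -- partial summation on blocks
  have hblock : ∀ n ε, 0 < ε → (∀ j, n ≤ j → |τ j| ≤ ε) → ∀ m,
      |∑ j ∈ Finset.range m, ρ (n + j) * a (n + j)| ≤ 2 * ε * ρ n := by
    intro n ε hε h m
    -- With the boundary term included, each step changes the sum by `(ρ_j - ρ_{j+1}) τ_{j+1}`, and
    -- these bounds telescope.
    have h1 : |∑ j ∈ Finset.range m, ρ (n + j) * a (n + j) + ρ (n + m) * τ (n + m)|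
        ≤ ε * (2 * ρ n - ρ (n + m)) := by
      induction m with
      | zero =>
        simp only [Finset.range_zero, Finset.sum_empty, zero_add, add_zero]
        rw [abs_mul, abs_of_pos (hρ n)]
        nlinarith [h n le_rfl, hρ n]
      | succ m ih =>
        rw [Finset.sum_range_succ, haτ]
        have e : ∑ j ∈ Finset.range m, ρ (n + j) * a (n + j)
            + ρ (n + m) * (τ (n + m) - τ (n + m + 1)) + ρ (n + (m + 1)) * τ (n + (m + 1))
            = (∑ j ∈ Finset.range m, ρ (n + j) * a (n + j) + ρ (n + m) * τ (n + m))
              - (ρ (n + m) - ρ (n + (m + 1))) * τ (n + (m + 1)) := by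
          rw [← add_assoc n m 1]; ring
        rw [e]
        have hd : 0 ≤ ρ (n + m) - ρ (n + (m + 1)) := sub_nonneg.2 (hanti (by omega))
        refine (abs_sub _ _).trans ?_
        rw [abs_mul, abs_of_nonneg hd]
        nlinarith [h (n + (m + 1)) (by omega)]
    have h2 : |ρ (n + m) * τ (n + m)| ≤ ε * ρ (n + m) := by
      rw [abs_mul, abs_of_pos (hρ _), mul_comm]
      exact mul_le_mul_of_nonneg_right (h _ (by omega)) (hρ _).le
    rw [abs_le] at *
    constructor <;> nlinarith [h1.1, h1.2, h2.1, h2.2]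
  have hsmall : ∀ ε, 0 < ε → ∃ n0, ∀ n, n0 ≤ n → ∀ j, n ≤ j → |τ j| ≤ ε := by
    intro ε hε
    obtain ⟨n0, h⟩ := (Metric.tendsto_atTop.1 hτ0) ε hε
    refine ⟨n0, fun n hn j hj => ?_⟩
    have := h j (hn.trans hj)
    rw [Real.dist_eq, sub_zero] at this
    exact this.le
  set T : ℕ → ℝ := fun n => ∑ j ∈ Finset.range n, ρ j * a j with hT
  have hTb : ∀ n m, T (n + m) - T n = ∑ j ∈ Finset.range m, ρ (n + j) * a (n + j) := by
    intro n m
    simp [hT, Finset.sum_range_add]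
  have hcau : CauchySeq T := by
    refine Metric.cauchySeq_iff'.2 fun ε hε => ?_
    have h0 : 0 < ε / (4 * ρ 0) := div_pos hε (by linarith [hρ 0])
    obtain ⟨n0, hn0⟩ := hsmall _ h0
    refine ⟨n0, fun n hn => ?_⟩
    obtain ⟨m, rfl⟩ := Nat.exists_eq_add_of_le hn
    rw [Real.dist_eq, hTb]
    refine (hblock n0 _ h0 (hn0 n0 le_rfl) m).trans_lt ?_
    have : ε / (4 * ρ 0) * ρ n0 ≤ ε / (4 * ρ 0) * ρ 0 :=
      mul_le_mul_of_nonneg_left (hanti (Nat.zero_le _)) h0.le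
    have e : ε / (4 * ρ 0) * ρ 0 = ε / 4 := by
      have := (hρ 0).ne'
      field_simp
    linarith
  obtain ⟨L, hL⟩ := cauchySeq_tendsto_of_complete hcau
  refine ⟨fun n => L - T n, fun n => by simp [hT, Finset.sum_range_succ]; ring, ?_⟩
  refine isLittleO_iff.2 fun ε hε => ?_
  obtain ⟨n0, hn0⟩ := hsmall (ε / 2) (half_pos hε)
  filter_upwards [eventually_ge_atTop n0] with n hn
  -- The block bound is uniform in the length `m`, so it survives `m → ∞`.
  have h1 : Tendsto (fun m => |T (n + m) - T n|) atTop (𝓝 |L - T n|) := by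
    have : Tendsto (fun m => T (n + m)) atTop (𝓝 L) := by
      simpa [add_comm] using (tendsto_add_atTop_iff_nat n).2 hL
    exact (this.sub_const _).abs
  rw [Real.norm_eq_abs, Real.norm_eq_abs, abs_of_pos (hρ n)]
  refine le_of_tendsto' h1 fun m => ?_
  rw [hTb]
  refine (hblock n _ (half_pos hε) (hn0 n hn) m).trans (le_of_eq (by ring))

/-- The weighted noise of a stochastic approximation process with step sizes `1 / (n + 1)` has
tails of order `o(n ^ (-ρ))` for every `ρ < 1 / 2 - γ`. -/
theorem IsRegularNoise.exists_tail {Ω : Type*} {mΩ : MeasurableSpace Ω} {μ : Measure Ω}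
    [IsProbabilityMeasure μ] {𝒯 : Filtration ℕ mΩ} {ε : ℕ → Ω → ℝ} (h : IsRegularNoise μ 𝒯 ε)
    {γ ρ : ℝ} (hρ : 0 < ρ) (hργ : ρ < 1 / 2 - γ) :
    ∀ᵐ ω ∂μ, ∃ N : ℕ → ℝ,
      (∀ n : ℕ, 1 ≤ n → N (n + 1) = N n - ((n : ℝ) + 1) ^ (γ - 1) * ε (n + 1) ω) ∧
      N =o[atTop] fun n : ℕ => (n : ℝ) ^ (-ρ) := by
  obtain ⟨s, -, hs⟩ := h.variance_tendsto
  -- The noise starts at index 2: `ξ n = ε (n + 2)` has conditional mean zero given `ℱ n = 𝒯 (n +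
  -- 1)`.
  let ℱ : Filtration ℕ mΩ :=
    ⟨fun n => 𝒯 (n + 1), fun i j hij => 𝒯.mono (Nat.succ_le_succ hij), fun n => 𝒯.le _⟩
  -- The weight splits as `(n + 2) ^ (-ρ) * (n + 2) ^ (γ - 1 + ρ)`; the second factor is square
  -- summable exactly when `ρ < 1/2 - γ`, the first gives the decay of the tail.
  have hc : Summable fun n : ℕ => (((n : ℝ) + 2) ^ (γ - 1 + ρ)) ^ 2 := by
    have h1 : Summable fun n : ℕ => (n : ℝ) ^ (2 * (γ - 1 + ρ)) :=
      Real.summable_nat_rpow.2 (by linarith)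
    refine ((summable_nat_add_iff 2).2 h1).congr fun n => ?_
    rw [← Real.rpow_mul_natCast (by positivity)]
    push_cast
    rw [mul_comm]
  have key := exists_tendsto_sum_of_condVar_tendsto μ ℱ (fun n => ε (n + 2))
    (fun n : ℕ => ((n : ℝ) + 2) ^ (γ - 1 + ρ)) (s ^ 2)
    (fun n => (h.adapted (n + 2) (by omega)).stronglyMeasurable)
    (fun n => h.memLp (n + 2) (by omega))
    (fun n => h.martingale_difference (n + 1) (by omega))
    (by
      filter_upwards [hs] with ω hω
      exact (tendsto_add_atTop_iff_nat 1).2 hω) hc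
  filter_upwards [key] with ω ⟨l, hl⟩
  obtain ⟨N, hN, hNo⟩ := exists_tail_isLittleO (ρ := fun n : ℕ => ((n : ℝ) + 2) ^ (-ρ)) hl
    (fun n => by positivity)
    (fun m n hmn => Real.rpow_le_rpow_of_nonpos (by positivity) (by gcongr) (by linarith))
  refine ⟨fun n => N (n - 1), fun n hn => ?_, ?_⟩
  · obtain ⟨m, rfl⟩ := Nat.exists_eq_add_of_le' hn
    simp only [Nat.add_sub_cancel]
    rw [hN]
    push_cast
    have e : (m : ℝ) + 1 + 1 = m + 2 := by ring
    rw [e, ← mul_assoc, ← Real.rpow_add (by positivity)]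
    congr 3
    ring
  · have h1 : (fun n => N (n - 1)) =o[atTop]
        ((fun n : ℕ => ((n : ℝ) + 2) ^ (-ρ)) ∘ fun n : ℕ => n - 1) :=
      hNo.comp_tendsto (tendsto_sub_atTop_nat 1)
    refine h1.trans_isBigO (IsBigO.of_bound 1 ?_)
    filter_upwards [eventually_ge_atTop 1] with n hn
    simp only [Function.comp, one_mul]
    rw [Real.norm_of_nonneg (by positivity), Real.norm_of_nonneg (by positivity)]
    refine Real.rpow_le_rpow_of_nonpos (by positivity) ?_ (by linarith)
    rw [Nat.cast_sub hn]
    push_cast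
    linarith

/-! ### Taylor expansion with Peano remainder within a set -/

/-- Integration of an asymptotic bound for a derivative on a set which is convex near `x`. -/
theorem isLittleO_of_hasDerivWithinAt {s : Set ℝ} {x : ℝ} (hx : x ∈ s)
    (hs : ∃ U ∈ 𝓝 x, (s ∩ U).OrdConnected) {g g' : ℝ → ℝ} {m : ℕ}
    (hg : ∀ᶠ y in 𝓝[s] x, HasDerivWithinAt g (g' y) s y) (hgx : g x = 0)
    (hg' : g' =o[𝓝[s] x] fun y => (y - x) ^ m) :
    g =o[𝓝[s] x] fun y => (y - x) ^ (m + 1) := by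
  obtain ⟨U, hU, hconn⟩ := hs
  refine isLittleO_iff.2 fun c hc => ?_
  have h1 := (hg.and (isLittleO_iff.1 hg' hc))
  obtain ⟨r, hr, hball⟩ := Metric.mem_nhdsWithin_iff.1 h1
  obtain ⟨r', hr', hballU⟩ := Metric.mem_nhds_iff.1 hU
  refine Metric.mem_nhdsWithin_iff.2 ⟨min r r', lt_min hr hr', fun y hy => ?_⟩
  obtain ⟨hyb, hys⟩ := hy
  have hyU : y ∈ U := hballU (Metric.ball_subset_ball (min_le_right _ _) hyb)
  have hxU : x ∈ U := mem_of_mem_nhds hU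
  have hsub : Set.uIcc x y ⊆ s ∩ U := hconn.uIcc_subset ⟨hx, hxU⟩ ⟨hys, hyU⟩
  have hdist : ∀ z ∈ Set.uIcc x y, |z - x| ≤ |y - x| := fun z hz => by
    have := Set.abs_sub_left_of_mem_uIcc hz
    exact this
  have hz : ∀ z ∈ Set.uIcc x y, HasDerivWithinAt g (g' z) s z ∧ ‖g' z‖ ≤ c * ‖(z - x) ^ m‖ := by
    intro z hz
    refine hball ⟨?_, (hsub hz).1⟩
    have h2 := hdist z hz
    rw [Metric.mem_ball, Real.dist_eq] at hyb ⊢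
    exact (h2.trans_lt hyb).trans_le (min_le_left _ _)
  -- Mean value inequality on the segment from `x` to `y`, which stays in `s` by
  -- order-connectedness.
  have hmv := (convex_uIcc x y).norm_image_sub_le_of_norm_hasDerivWithin_le
    (f := g) (f' := g') (C := c * |y - x| ^ m)
    (fun z h => (hz z h).1.mono (hsub.trans Set.inter_subset_left))
    (fun z h => (hz z h).2.trans (by
      rw [norm_pow, Real.norm_eq_abs]
      exact mul_le_mul_of_nonneg_left (pow_le_pow_left₀ (abs_nonneg _) (hdist z h) m) hc.le))
    Set.left_mem_uIcc Set.right_mem_uIcc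
  rw [hgx, sub_zero] at hmv
  simp only [Set.mem_ofPred_eq, norm_pow]
  rw [pow_succ, ← mul_assoc]
  exact hmv

/-- Taylor's theorem with Peano remainder for a function which is `k` times differentiable at a
point `x` of `s`, where `s` is an interval near `x`. -/
theorem TimesDifferentiableWithinAt.taylor {k : ℕ} {f : ℝ → ℝ} {s : Set ℝ} {x : ℝ} (hx : x ∈ s)
    (hs : ∃ U ∈ 𝓝 x, (s ∩ U).OrdConnected) (hk : 1 ≤ k)
    (hf : TimesDifferentiableWithinAt k f s x) :
    (fun y => f y - ∑ l ∈ Finset.range (k + 1),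
        iteratedDerivWithin l f s x / (Nat.factorial l : ℝ) * (y - x) ^ l)
      =o[𝓝[s] x] fun y => (y - x) ^ k := by
  -- Expand the `i`-th derivative to order `k - i`, descending in `i`: `i = k - 1` is
  -- differentiability at `x`, and each further step integrates once.
  have key : ∀ m i : ℕ, i + (m + 1) = k →
      (fun y => iteratedDerivWithin i f s y - ∑ l ∈ Finset.range (m + 2),
          iteratedDerivWithin (i + l) f s x / (Nat.factorial l : ℝ) * (y - x) ^ l)
        =o[𝓝[s] x] fun y => (y - x) ^ (m + 1) := by
    intro m
    induction m with
    | zero =>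
      intro i hi
      have h1 := (hf.2 i (by omega)).hasDerivWithinAt
      rw [← iteratedDerivWithin_succ, hasDerivWithinAt_iff_isLittleO] at h1
      refine h1.congr (fun y => ?_) (fun y => by simp)
      simp [Finset.sum_range_succ]
      ring
    | succ m ih =>
      intro i hi
      refine isLittleO_of_hasDerivWithinAt hx hs (g' := fun y => iteratedDerivWithin (i + 1) f s y
        - ∑ l ∈ Finset.range (m + 2),
          iteratedDerivWithin (i + 1 + l) f s x / (Nat.factorial l : ℝ) * (y - x) ^ l) ?_ ?_
        (ih (i + 1) (by omega))
      · filter_upwards [hf.1 i (by omega)] with y hy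
        rw [iteratedDerivWithin_succ]
        refine hy.hasDerivWithinAt.sub ?_
        have e : (fun y : ℝ => ∑ l ∈ Finset.range (m + 1 + 2),
            iteratedDerivWithin (i + l) f s x / (Nat.factorial l : ℝ) * (y - x) ^ l)
            = fun y => ∑ l ∈ Finset.range (m + 2),
              iteratedDerivWithin (i + 1 + l) f s x / (Nat.factorial (l + 1) : ℝ)
                * (y - x) ^ (l + 1) + iteratedDerivWithin i f s x := by
          ext y
          rw [Finset.sum_range_succ']
          simp [add_assoc, add_comm 1]
        rw [e]
        refine (HasDerivWithinAt.fun_sum (A' := fun l =>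
          iteratedDerivWithin (i + 1 + l) f s x / (Nat.factorial l : ℝ) * (y - x) ^ l)
          fun l _ => ?_).add_const _
        have h2 := ((((hasDerivAt_id y).sub_const x).pow (l + 1)).const_mul
          (iteratedDerivWithin (i + 1 + l) f s x / (Nat.factorial (l + 1) : ℝ))).hasDerivWithinAt
            (s := s)
        refine HasDerivWithinAt.congr_deriv h2 ?_
        have h3 : (Nat.factorial l : ℝ) ≠ 0 := by positivity
        have h4 : (l : ℝ) + 1 ≠ 0 := by positivity
        have h5 : (Nat.factorial (l + 1) : ℝ) = ((l : ℝ) + 1) * Nat.factorial l := by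
          rw [Nat.factorial_succ]; push_cast; ring
        rw [h5]
        simp only [id, Nat.add_sub_cancel, Nat.cast_add, Nat.cast_one, mul_one]
        field_simp
      · rw [Finset.sum_range_succ']
        simp
  obtain ⟨m, rfl⟩ := Nat.exists_eq_add_of_le' hk
  simpa using key m 0 (by omega)

theorem TimesDifferentiableWithinAt.of_le {k m : ℕ} {f : ℝ → ℝ} {s : Set ℝ} {x : ℝ}
    (hf : TimesDifferentiableWithinAt k f s x) (h : m ≤ k) :
    TimesDifferentiableWithinAt m f s x :=
  ⟨fun i hi => hf.1 i (by omega), fun i hi => hf.2 i (by omega)⟩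

/-- The expansion of the remainder of the linearisation along a sequence in the domain. -/
theorem linearRemainder_expansion {k : ℕ} {ψ : ℝ → ℝ} {s : Set ℝ} {θ₀ : ℝ} (hθ : θ₀ ∈ s)
    (hs : ∃ U ∈ 𝓝 θ₀, (s ∩ U).OrdConnected) (hk : 1 ≤ k)
    (hf : TimesDifferentiableWithinAt k ψ s θ₀) (hzero : ψ θ₀ = 0) {x : ℕ → ℝ}
    (hx : Tendsto x atTop (𝓝[s] θ₀)) :
    (fun n => linearRemainder ψ s θ₀ (x n - θ₀) - ∑ i ∈ Finset.Icc 2 k,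
        iteratedDerivWithin i ψ s θ₀ / (Nat.factorial i : ℝ) * (x n - θ₀) ^ i)
      =o[atTop] fun n => (x n - θ₀) ^ k := by
  have h := (hf.taylor hθ hs hk).comp_tendsto hx
  refine h.congr (fun n => ?_) fun n => rfl
  have e : Finset.range (k + 1) = insert 0 (insert 1 (Finset.Icc 2 k)) := by
    ext i; simp only [Finset.mem_range, Finset.mem_insert, Finset.mem_Icc]; omega
  simp only [Function.comp, linearRemainder]
  rw [e, Finset.sum_insert (by simp), Finset.sum_insert (by simp)]
  simp [hzero]
  ring

/-! ### Powers of expansions -/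

/-- A sum over compositions of a symmetric function is a sum over sorted compositions weighted by
the number of arrangements. -/
theorem sum_piAntidiag_eq_sum_partitionSeqs (i t : ℕ) (F : (Fin i → ℕ) → ℝ)
    (hF : ∀ (c : Fin i → ℕ) (σ : Equiv.Perm (Fin i)), F (c ∘ σ) = F c) :
    ∑ c ∈ (Finset.piAntidiag Finset.univ t).filter (fun c : Fin i → ℕ => ∀ j, 1 ≤ c j), F c
      = ∑ c ∈ partitionSeqs i t, (arrangements c : ℝ) * F c := by
  classical
  -- Group compositions by their sorted version; each fibre is a permutation orbit, with
  -- `arrangements d` elements, on which `F` is constant.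
  rw [← Finset.sum_fiberwise_of_maps_to (t := partitionSeqs i t)
    (g := fun c => c ∘ Tuple.sort c)]
  · refine Finset.sum_congr rfl fun d hd => ?_
    obtain ⟨hd1, hd2, hd3⟩ := mem_partitionSeqs.1 hd
    have e : Finset.filter (fun c => c ∘ Tuple.sort c = d)
        ((Finset.piAntidiag Finset.univ t).filter (fun c : Fin i → ℕ => ∀ j, 1 ≤ c j))
        = Finset.univ.image (fun σ : Equiv.Perm (Fin i) => d ∘ σ) := by
      ext c
      simp only [Finset.mem_filter, Finset.mem_piAntidiag, Finset.mem_image, Finset.mem_univ,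
        true_and]
      constructor
      · rintro ⟨-, rfl⟩
        exact ⟨(Tuple.sort c)⁻¹, by ext j; simp⟩
      · rintro ⟨σ, rfl⟩
        refine ⟨⟨⟨?_, fun j _ => trivial⟩, fun j => hd2 _⟩, ?_⟩
        · rw [← hd1]; exact Equiv.sum_comp σ d
        · rw [Tuple.comp_perm_comp_sort_eq_comp_sort, (Tuple.sort_eq_refl_iff_monotone.2 hd3)]
          rfl
    rw [e, Finset.sum_congr rfl (g := fun _ => F d), Finset.sum_const, nsmul_eq_mul, arrangements]
    intro c hc
    obtain ⟨σ, -, rfl⟩ := Finset.mem_image.1 hc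
    exact hF d σ
  · intro c hc
    simp only [Finset.mem_filter, Finset.mem_piAntidiag] at hc
    refine mem_partitionSeqs.2 ⟨?_, fun j => hc.2 _, Tuple.monotone_sort c⟩
    rw [← hc.1.1]
    exact Equiv.sum_comp (Tuple.sort c) c

/-- Expansion of a power of a polynomial without constant term. -/
theorem sum_mul_pow_pow_isLittleO {b : ℕ → ℝ} {m i : ℕ} (hi : 2 ≤ i) {q z : ℕ → ℝ}
    (hq : Tendsto q atTop (𝓝 0)) (hz : z =O[atTop] q) :
    (fun n => (∑ j ∈ Finset.Icc 1 m, b j * z n ^ j) ^ i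
        - ∑ t ∈ Finset.Icc 2 (m + 1),
          (∑ c ∈ partitionSeqs i t, (arrangements c : ℝ) * ∏ j, b (c j)) * z n ^ t)
      =o[atTop] fun n => q n ^ (m + 1) := by
  classical
  set P : Finset (Fin i → ℕ) := Fintype.piFinset fun _ => Finset.Icc 1 m with hP
  have hsumP : ∀ c ∈ P, 2 ≤ ∑ j, c j := by
    intro c hc
    have h1 : ∑ j : Fin i, 1 ≤ ∑ j, c j := Finset.sum_le_sum fun j _ =>
      (Finset.mem_Icc.1 (Fintype.mem_piFinset.1 hc j)).1
    simp at h1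
    omega
  have hexp : ∀ n, (∑ j ∈ Finset.Icc 1 m, b j * z n ^ j) ^ i
      = ∑ c ∈ P, (∏ j, b (c j)) * z n ^ (∑ j, c j) := by
    intro n
    have h := Finset.prod_univ_sum (fun _ : Fin i => Finset.Icc 1 m)
      (fun _ j => b j * z n ^ j)
    rw [Finset.prod_const, Finset.card_univ, Fintype.card_fin] at h
    rw [h]
    refine Finset.sum_congr rfl fun c _ => ?_
    rw [Finset.prod_mul_distrib, Finset.prod_pow_eq_pow_sum]
  -- As `i ≥ 2`, every part of a composition of `t ≤ m + 1` is at most `m`, so the truncated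
  -- polynomial already has the right coefficients.
  have hcoeff : ∀ t ∈ Finset.Icc 2 (m + 1),
      ∑ c ∈ partitionSeqs i t, (arrangements c : ℝ) * ∏ j, b (c j)
        = ∑ c ∈ P.filter (fun c => ∑ j, c j = t), ∏ j, b (c j) := by
    intro t ht
    rw [← sum_piAntidiag_eq_sum_partitionSeqs i t (fun c => ∏ j, b (c j))
      (fun c σ => Equiv.prod_comp σ (fun j => b (c j)))]
    refine Finset.sum_congr ?_ fun _ _ => rfl
    ext c
    simp only [Finset.mem_filter, Finset.mem_piAntidiag, hP, Fintype.mem_piFinset, Finset.mem_Icc]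
    constructor
    · rintro ⟨⟨h1, -⟩, h2⟩
      refine ⟨fun j => ⟨h2 j, ?_⟩, h1⟩
      have : Nontrivial (Fin i) := Fin.nontrivial_iff_two_le.2 hi
      obtain ⟨l, hl⟩ := exists_ne j
      have h : ∑ m ∈ ({l, j} : Finset (Fin i)), c m ≤ ∑ m, c m :=
        Finset.sum_le_sum_of_subset (Finset.subset_univ _)
      rw [Finset.sum_pair hl, h1] at h
      have := h2 l
      have := (Finset.mem_Icc.1 ht).2
      omega
    · rintro ⟨h1, h2⟩
      exact ⟨⟨h2, fun _ _ => Finset.mem_univ _⟩, fun j => (h1 j).1⟩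
  have hrest : ∀ n, (∑ j ∈ Finset.Icc 1 m, b j * z n ^ j) ^ i
        - ∑ t ∈ Finset.Icc 2 (m + 1),
          (∑ c ∈ partitionSeqs i t, (arrangements c : ℝ) * ∏ j, b (c j)) * z n ^ t
      = ∑ c ∈ P.filter (fun c => ¬ ∑ j, c j ≤ m + 1), (∏ j, b (c j)) * z n ^ (∑ j, c j) := by
    intro n
    rw [hexp, ← Finset.sum_filter_add_sum_filter_not P (fun c => ∑ j, c j ≤ m + 1),
      ← Finset.sum_fiberwise_of_maps_to (s := P.filter (fun c => ∑ j, c j ≤ m + 1))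
        (t := Finset.Icc 2 (m + 1)) (g := fun c => ∑ j, c j)]
    · rw [add_sub_right_comm, add_eq_right, sub_eq_zero]
      refine Finset.sum_congr rfl fun t ht => ?_
      rw [hcoeff t ht, Finset.sum_mul, Finset.filter_filter]
      refine Finset.sum_congr ?_ fun c hc => ?_
      · refine Finset.filter_congr fun c _ => ?_
        have := (Finset.mem_Icc.1 ht).2
        constructor
        · rintro ⟨-, h⟩; exact h
        · rintro h; exact ⟨h ▸ this, h⟩
      · rw [(Finset.mem_filter.1 hc).2]
    · intro c hc
      rw [Finset.mem_filter] at hc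
      exact Finset.mem_Icc.2 ⟨hsumP c hc.1, hc.2⟩
  simp_rw [hrest]
  refine IsLittleO.fun_sum fun c hc => IsLittleO.const_mul_left ?_ _
  have hc' : m + 1 < ∑ j, c j := not_le.1 (Finset.mem_filter.1 hc).2
  refine (hz.pow _).trans_isLittleO ?_
  exact (isLittleO_pow_pow hc').comp_tendsto hq

/-- The expansion of the higher-order part of a drift along an approximate solution. -/
theorem sum_pow_expansion {d : ℕ → ℝ} (hd : d 1 ≠ 0) {m : ℕ} {q z x : ℕ → ℝ}
    (hq : Tendsto q atTop (𝓝 0)) (hz : z =O[atTop] q) (hm : 1 ≤ m)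
    (hx : (fun n => x n - ∑ j ∈ Finset.Icc 1 m, expansionCoeff d j * z n ^ j)
      =o[atTop] fun n => q n ^ m) :
    x =O[atTop] q ∧
    (fun n => ∑ i ∈ Finset.Icc 2 (m + 1), d i / (Nat.factorial i : ℝ) * x n ^ i
        - ∑ t ∈ Finset.Icc 2 (m + 1), d 1 * ((t : ℝ) - 1) * expansionCoeff d t * z n ^ t)
      =o[atTop] fun n => q n ^ (m + 1) := by
  set B : ℕ → ℝ := fun n => ∑ j ∈ Finset.Icc 1 m, expansionCoeff d j * z n ^ j with hB
  have hpow : ∀ j, 1 ≤ j → (fun n => q n ^ j) =O[atTop] q := by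
    intro j hj
    rcases hj.eq_or_lt with rfl | hj
    · simpa using isBigO_refl q atTop
    · have h := (isLittleO_pow_pow (𝕜 := ℝ) hj).comp_tendsto hq
      exact h.isBigO.congr (fun n => rfl) fun n => by simp
  have hBq : B =O[atTop] q := by
    refine IsBigO.fun_sum fun j hj => IsBigO.const_mul_left ?_ _
    exact (hz.pow j).trans (hpow j (Finset.mem_Icc.1 hj).1)
  have hxq : x =O[atTop] q := by
    exact ((hx.isBigO.trans (hpow m hm)).add hBq).congr_left fun n => by simp [hB]
  refine ⟨hxq, ?_⟩
  -- The gain of one order: in `x ^ i - B ^ i = (x - B) * ∑ …` the second factor has degree `i - 1 ≥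
  -- 1`, hence is `O(q)`.
  have hdiff : ∀ i, 2 ≤ i → (fun n => x n ^ i - B n ^ i) =o[atTop] fun n => q n ^ (m + 1) := by
    intro i hi
    have e : ∀ n, x n ^ i - B n ^ i
        = (x n - B n) * ∑ l ∈ Finset.range i, x n ^ l * B n ^ (i - 1 - l) := by
      intro n
      rw [mul_comm, (Commute.all _ _).geom_sum₂_mul]
    simp_rw [e, pow_succ (q _)]
    refine hx.mul_isBigO (IsBigO.fun_sum fun l hl => ?_)
    have h1 := (hxq.pow l).mul (hBq.pow (i - 1 - l))
    refine h1.trans ?_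
    simp_rw [← pow_add]
    refine hpow _ ?_
    have := Finset.mem_range.1 hl
    omega
  have hterm : ∀ i ∈ Finset.Icc 2 (m + 1),
      (fun n => d i / (Nat.factorial i : ℝ) * x n ^ i
        - d i / (Nat.factorial i : ℝ) * ∑ t ∈ Finset.Icc 2 (m + 1),
          (∑ c ∈ partitionSeqs i t, (arrangements c : ℝ) * ∏ j, expansionCoeff d (c j)) * z n ^ t)
        =o[atTop] fun n => q n ^ (m + 1) := by
    intro i hi
    have hi2 := (Finset.mem_Icc.1 hi).1
    have := ((hdiff i hi2).add (sum_mul_pow_pow_isLittleO (b := expansionCoeff d) (m := m) hi2 hq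
      hz)).const_mul_left (d i / (Nat.factorial i : ℝ))
    refine this.congr (fun n => ?_) fun n => rfl
    simp only [hB]
    ring
  refine (IsLittleO.fun_sum hterm).congr (fun n => ?_) fun n => rfl
  rw [Finset.sum_sub_distrib]
  congr 1
  simp_rw [Finset.mul_sum]
  rw [Finset.sum_comm]
  refine Finset.sum_congr rfl fun t ht => ?_
  obtain ⟨ht2, htm⟩ := Finset.mem_Icc.1 ht
  have htne : (t : ℝ) - 1 ≠ 0 := by
    have : (2 : ℝ) ≤ t := by exact_mod_cast ht2
    linarith
  rw [expansionCoeff_recursion d ht2]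
  have e : d 1 * ((t : ℝ) - 1) * (1 / (d 1 * ((t : ℝ) - 1)) *
      ∑ i ∈ Finset.Icc 2 t, d i / (Nat.factorial i : ℝ) *
        ∑ c ∈ partitionSeqs i t, (arrangements c : ℝ) * ∏ j, expansionCoeff d (c j))
      = ∑ i ∈ Finset.Icc 2 t, d i / (Nat.factorial i : ℝ) *
        ∑ c ∈ partitionSeqs i t, (arrangements c : ℝ) * ∏ j, expansionCoeff d (c j) := by
    field_simp
  rw [e, Finset.sum_mul]
  symm
  -- Terms with `i > t` vanish: `t` is not a sum of `i` positive parts.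
  refine (Finset.sum_subset (Finset.Icc_subset_Icc_right htm) fun i hi hit => ?_).trans
    (Finset.sum_congr rfl fun i _ => by ring)
  have hlt : t < i := by
    simp only [Finset.mem_Icc] at hi hit
    omega
  have hempty : partitionSeqs i t = ∅ := by
    refine Finset.eq_empty_of_forall_notMem fun c hc => ?_
    obtain ⟨h1, h2, -⟩ := mem_partitionSeqs.1 hc
    have h3 : ∑ j : Fin i, 1 ≤ ∑ j, c j := Finset.sum_le_sum fun j _ => h2 j
    simp at h3
    omega
  simp [hempty]

/-! ### Asymptotics of powers along the natural numbers -/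

theorem natCast_rpow_isLittleO {a b : ℝ} (h : a < b) :
    (fun n : ℕ => (n : ℝ) ^ a) =o[atTop] fun n : ℕ => (n : ℝ) ^ b := by
  have h0 : Tendsto (fun n : ℕ => (n : ℝ) ^ (-(b - a))) atTop (𝓝 0) :=
    (tendsto_rpow_neg_atTop (sub_pos.2 h)).comp tendsto_natCast_atTop_atTop
  refine (isLittleO_iff_tendsto' ?_).2 (h0.congr' ?_)
  · filter_upwards [eventually_gt_atTop 0] with n hn h1
    have : (0 : ℝ) < n := by exact_mod_cast hn
    exact absurd h1 (by positivity)
  · filter_upwards [eventually_gt_atTop 0] with n hn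
    rw [neg_sub, Real.rpow_sub (by exact_mod_cast hn)]

theorem natCast_rpow_isBigO {a b : ℝ} (h : a ≤ b) :
    (fun n : ℕ => (n : ℝ) ^ a) =O[atTop] fun n : ℕ => (n : ℝ) ^ b := by
  rcases h.eq_or_lt with rfl | h
  · exact isBigO_refl _ _
  · exact (natCast_rpow_isLittleO h).isBigO

theorem natCast_rpow_mul_rpow (a b : ℝ) :
    (fun n : ℕ => (n : ℝ) ^ a * (n : ℝ) ^ b) =ᶠ[atTop] fun n : ℕ => (n : ℝ) ^ (a + b) := by
  filter_upwards [eventually_gt_atTop 0] with n hn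
  rw [Real.rpow_add (by exact_mod_cast hn)]

theorem Asymptotics.IsBigO.mul_natCast_rpow {f g : ℕ → ℝ} {a b c : ℝ}
    (hf : f =O[atTop] fun n : ℕ => (n : ℝ) ^ a) (hg : g =O[atTop] fun n : ℕ => (n : ℝ) ^ b)
    (h : a + b ≤ c) : (fun n => f n * g n) =O[atTop] fun n : ℕ => (n : ℝ) ^ c :=
  ((hf.mul hg).congr' EventuallyEq.rfl (natCast_rpow_mul_rpow a b)).trans (natCast_rpow_isBigO h)

theorem Asymptotics.IsBigO.mul_natCast_rpow_of_lt {f g : ℕ → ℝ} {a b c : ℝ}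
    (hf : f =O[atTop] fun n : ℕ => (n : ℝ) ^ a) (hg : g =O[atTop] fun n : ℕ => (n : ℝ) ^ b)
    (h : a + b < c) : (fun n => f n * g n) =o[atTop] fun n : ℕ => (n : ℝ) ^ c :=
  (hf.mul_natCast_rpow hg le_rfl).trans_isLittleO (natCast_rpow_isLittleO h)

theorem Asymptotics.IsBigO.mul_isLittleO_natCast_rpow {f g : ℕ → ℝ} {a b c : ℝ}
    (hf : f =O[atTop] fun n : ℕ => (n : ℝ) ^ a) (hg : g =o[atTop] fun n : ℕ => (n : ℝ) ^ b)
    (h : a + b ≤ c) : (fun n => f n * g n) =o[atTop] fun n : ℕ => (n : ℝ) ^ c :=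
  ((hf.mul_isLittleO hg).congr' EventuallyEq.rfl (natCast_rpow_mul_rpow a b)).trans_isBigO
    (natCast_rpow_isBigO h)

theorem natCast_add_one_rpow_isBigO (a : ℝ) :
    (fun n : ℕ => ((n : ℝ) + 1) ^ a) =O[atTop] fun n : ℕ => (n : ℝ) ^ a := by
  refine IsBigO.of_bound ((2 : ℝ) ^ |a|) ?_
  filter_upwards [eventually_ge_atTop 1] with n hn
  have h1 : (1 : ℝ) ≤ n := by exact_mod_cast hn
  rw [Real.norm_of_nonneg (by positivity), Real.norm_of_nonneg (by positivity)]
  rcases le_total 0 a with ha | ha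
  · rw [abs_of_nonneg ha, ← Real.mul_rpow (by norm_num) (by positivity)]
    exact Real.rpow_le_rpow (by positivity) (by linarith) ha
  · refine (Real.rpow_le_rpow_of_nonpos (by positivity) (by linarith : (n : ℝ) ≤ n + 1) ha).trans
      (le_mul_of_one_le_left (by positivity) ?_)
    exact Real.one_le_rpow (by norm_num) (abs_nonneg a)

theorem one_div_natCast_add_one_isBigO :
    (fun n : ℕ => 1 / ((n : ℝ) + 1)) =O[atTop] fun n : ℕ => (n : ℝ) ^ (-1 : ℝ) := by
  refine (natCast_add_one_rpow_isBigO (-1)).congr_left fun n => ?_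
  rw [Real.rpow_neg_one, one_div]

theorem natCast_add_one_isBigO :
    (fun n : ℕ => (n : ℝ) + 1) =O[atTop] fun n : ℕ => (n : ℝ) ^ (1 : ℝ) :=
  (natCast_add_one_rpow_isBigO 1).congr_left fun _ => Real.rpow_one _

/-! ### Elementary step estimates -/

/-- Bernoulli's inequality for exponents in `[0, 1]`, at `-1 / (n + 1)`. -/
theorem div_add_one_rpow_le {p : ℝ} (hp : 0 ≤ p) (hp1 : p ≤ 1) {n : ℕ} :
    ((n : ℝ) / (n + 1)) ^ p ≤ 1 - p / (n + 1) := by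
  have hn : (0 : ℝ) < (n : ℝ) + 1 := by positivity
  have h := rpow_one_add_le_one_add_mul_self (s := -(1 / ((n : ℝ) + 1))) (p := p)
    (by rw [neg_le_neg_iff, div_le_one hn]; linarith [(Nat.cast_nonneg n : (0 : ℝ) ≤ n)]) hp hp1
  have e : (1 : ℝ) + -(1 / ((n : ℝ) + 1)) = n / (n + 1) := by field_simp; ring
  rw [e] at h
  refine h.trans (le_of_eq ?_)
  ring

/-- Bernoulli at `1 / n` for the reciprocal, combined with `(1 - p / n) (1 + p / n) ≤ 1`. -/
theorem le_div_add_one_rpow {p : ℝ} (hp : 0 ≤ p) (hp1 : p ≤ 1) {n : ℕ} (hn : 1 ≤ n) :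
    1 - p / n ≤ ((n : ℝ) / (n + 1)) ^ p := by
  have hn0 : (0 : ℝ) < n := by exact_mod_cast hn
  have h := rpow_one_add_le_one_add_mul_self (s := 1 / (n : ℝ)) (p := p)
    (by have : 0 < 1 / (n : ℝ) := by positivity
        linarith) hp hp1
  have e : (n : ℝ) / (n + 1) = (1 + 1 / (n : ℝ))⁻¹ := by field_simp
  rw [e, Real.inv_rpow (by positivity)]
  have hpos : 0 < (1 + 1 / (n : ℝ)) ^ p := by positivity
  have hq : 0 ≤ p / n := by positivity
  rw [← one_div, le_div_iff₀ hpos]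
  rcases le_total (1 - p / n) 0 with h0 | h0
  · nlinarith
  · have : p * (1 / (n : ℝ)) = p / n := by ring
    rw [this] at h
    nlinarith

theorem abs_div_add_one_rpow_sub_le {p : ℝ} (hp : 0 ≤ p) (hp1 : p ≤ 1) {n : ℕ} (hn : 1 ≤ n) :
    |((n : ℝ) / (n + 1)) ^ p - (1 - p / (n + 1))| ≤ (n : ℝ) ^ (-2 : ℝ) := by
  have hn0 : (1 : ℝ) ≤ n := by exact_mod_cast hn
  have h1 := div_add_one_rpow_le hp hp1 (n := n)
  have h2 := le_div_add_one_rpow hp hp1 hn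
  have h3 : (n : ℝ) ^ (-2 : ℝ) = 1 / (n : ℝ) ^ 2 := by
    rw [Real.rpow_neg (by positivity), one_div]; norm_cast
  have h4 : p / n - p / (n + 1) ≤ 1 / (n : ℝ) ^ 2 := by
    have e : p / n - p / (n + 1) = p / ((n : ℝ) * (n + 1)) := by field_simp; ring
    rw [e, div_le_div_iff₀ (by positivity) (by positivity)]
    nlinarith [mul_nonneg (by linarith : (0 : ℝ) ≤ 1 - p) (sq_nonneg (n : ℝ))]
  rw [h3, abs_le]
  have : 0 < 1 / (n : ℝ) ^ 2 := by positivity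
  constructor <;> linarith

/-- Each monomial of the ansatz almost solves a linear recursion, the monomial `n ^ (-p)` with rate
`p`. -/
theorem add_one_rpow_neg_sub_isBigO {p : ℝ} (hp : 0 ≤ p) (hp1 : p ≤ 1) :
    (fun n : ℕ => ((n : ℝ) + 1) ^ (-p) - (1 - p / (n + 1)) * (n : ℝ) ^ (-p))
      =O[atTop] fun n : ℕ => (n : ℝ) ^ (-p - 2) := by
  refine IsBigO.of_bound 1 ?_
  filter_upwards [eventually_ge_atTop 1] with n hn
  have hn0 : (0 : ℝ) < n := by exact_mod_cast hn
  have e : ((n : ℝ) + 1) ^ (-p) = (n / (n + 1)) ^ p * (n : ℝ) ^ (-p) := by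
    rw [Real.div_rpow (by positivity) (by positivity), Real.rpow_neg (by positivity),
      Real.rpow_neg (by positivity)]
    field_simp
  rw [e, ← sub_mul, norm_mul, one_mul, sub_eq_add_neg (-p) 2, Real.rpow_add hn0, norm_mul,
    mul_comm]
  gcongr
  rw [Real.norm_eq_abs, Real.norm_of_nonneg (by positivity)]
  exact abs_div_add_one_rpow_sub_le hp hp1 hn

/-- The defect of `n ^ p` as an integrating factor. -/
theorem add_one_rpow_mul_sub_isBigO {p : ℝ} (hp : 0 ≤ p) (hp1 : p ≤ 1) :
    (fun n : ℕ => ((n : ℝ) + 1) ^ p * (1 - p / (n + 1)) - (n : ℝ) ^ p)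
      =O[atTop] fun n : ℕ => (n : ℝ) ^ (p - 2) := by
  have h1 : (fun n : ℕ => ((n : ℝ) / (n + 1)) ^ p - (1 - p / (n + 1)))
      =O[atTop] fun n : ℕ => (n : ℝ) ^ (-2 : ℝ) := by
    refine IsBigO.of_bound 1 ?_
    filter_upwards [eventually_ge_atTop 1] with n hn
    rw [Real.norm_eq_abs, one_mul, Real.norm_of_nonneg (by positivity)]
    exact abs_div_add_one_rpow_sub_le hp hp1 hn
  refine ((natCast_add_one_rpow_isBigO p).mul_natCast_rpow h1 (c := p - 2)
    (by linarith)).neg_left.congr_left fun n => ?_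
  rw [Real.div_rpow (by positivity) (by positivity)]
  have : ((n : ℝ) + 1) ^ p ≠ 0 := by positivity
  field_simp
  ring

/-- A null sequence with increments `o(n ^ (-1 - p))` is `o(n ^ (-p))`. -/
theorem isLittleO_of_increments {h : ℕ → ℝ} {p : ℝ} (hp : 0 < p) (hp1 : p ≤ 1)
    (h0 : Tendsto h atTop (𝓝 0))
    (hinc : (fun n => h (n + 1) - h n) =o[atTop] fun n : ℕ => (n : ℝ) ^ (-1 - p)) :
    h =o[atTop] fun n : ℕ => (n : ℝ) ^ (-p) := by
  refine isLittleO_iff.2 fun c hc => ?_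
  -- The factor `p / 2` is chosen because `n ^ (-p) - (n + 1) ^ (-p) ≥ (p / 2) * n ^ (-1 - p)`,
  -- using `n + 1 ≤ 2 n`.
  have h1 := isLittleO_iff.1 hinc (c := c * (p / 2)) (by positivity)
  obtain ⟨n0, hn0⟩ := eventually_atTop.1 (h1.and (eventually_ge_atTop 1))
  have hq : Tendsto (fun n : ℕ => (n : ℝ) ^ (-p)) atTop (𝓝 0) :=
    (tendsto_rpow_neg_atTop hp).comp tendsto_natCast_atTop_atTop
  have hstep : ∀ n, n0 ≤ n →
      |h (n + 1) - h n| ≤ c * ((n : ℝ) ^ (-p) - ((n + 1 : ℕ) : ℝ) ^ (-p)) := by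
    intro n hn
    obtain ⟨h2, h3⟩ := hn0 n hn
    have hn1 : (1 : ℝ) ≤ n := by exact_mod_cast h3
    rw [Real.norm_eq_abs, Real.norm_of_nonneg (by positivity)] at h2
    refine h2.trans ?_
    rw [mul_assoc]
    refine mul_le_mul_of_nonneg_left ?_ hc.le
    have e : ((n + 1 : ℕ) : ℝ) ^ (-p) = (n / (n + 1)) ^ p * (n : ℝ) ^ (-p) := by
      push_cast
      rw [Real.div_rpow (by positivity) (by positivity), Real.rpow_neg (by positivity),
        Real.rpow_neg (by positivity)]
      field_simp
    have h4 := div_add_one_rpow_le hp.le hp1 (n := n)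
    have h5 : p / 2 * (n : ℝ)⁻¹ ≤ p / (n + 1) := by
      rw [← div_eq_mul_inv, div_div, div_le_div_iff₀ (by positivity) (by positivity)]
      nlinarith
    have h6 : 0 < (n : ℝ) ^ (-p) := by positivity
    rw [e, sub_eq_add_neg (-1 : ℝ) p, Real.rpow_add (by positivity), Real.rpow_neg_one]
    nlinarith
  have hup : ∀ n, n0 ≤ n → h n ≤ c * (n : ℝ) ^ (-p) := by
    intro n hn
    -- An increasing sequence with limit `0` is nonpositive; the lower bound is symmetric.
    have hmono : Monotone fun m => h (n + m) - c * ((n + m : ℕ) : ℝ) ^ (-p) := by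
      refine monotone_nat_of_le_succ fun m => ?_
      have := hstep (n + m) (by omega)
      rw [abs_le] at this
      rw [← add_assoc]
      linarith [this.1]
    have hlim : Tendsto (fun m => h (n + m) - c * ((n + m : ℕ) : ℝ) ^ (-p)) atTop (𝓝 0) := by
      have := (h0.sub (hq.const_mul c)).comp (tendsto_add_atTop_nat n)
      simpa [Function.comp_def, add_comm] using this
    have := hmono.ge_of_tendsto hlim 0
    simp only [add_zero] at this
    linarith
  have hdown : ∀ n, n0 ≤ n → -(c * (n : ℝ) ^ (-p)) ≤ h n := by
    intro n hn
    have hanti : Antitone fun m => h (n + m) + c * ((n + m : ℕ) : ℝ) ^ (-p) := by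
      refine antitone_nat_of_succ_le fun m => ?_
      have := hstep (n + m) (by omega)
      rw [abs_le] at this
      rw [← add_assoc]
      linarith [this.2]
    have hlim : Tendsto (fun m => h (n + m) + c * ((n + m : ℕ) : ℝ) ^ (-p)) atTop (𝓝 0) := by
      have := (h0.add (hq.const_mul c)).comp (tendsto_add_atTop_nat n)
      simpa [Function.comp_def, add_comm] using this
    have := hanti.le_of_tendsto hlim 0
    simp only [add_zero] at this
    linarith
  filter_upwards [eventually_ge_atTop n0] with n hn
  rw [Real.norm_eq_abs, Real.norm_of_nonneg (by positivity), abs_le]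
  exact ⟨hdown n hn, hup n hn⟩

/-- A discrete Gronwall inequality. -/
theorem isBigO_of_le_one_add_div_mul {b : ℕ → ℝ} {η : ℝ} (hη : 0 ≤ η) (hη1 : η ≤ 1)
    (hb : ∀ n, 0 ≤ b n) (hrec : ∀ᶠ n : ℕ in atTop, b (n + 1) ≤ (1 + η / (n + 1)) * b n) :
    b =O[atTop] fun n : ℕ => (n : ℝ) ^ η := by
  obtain ⟨n0, hn0⟩ := eventually_atTop.1 (hrec.and (eventually_ge_atTop 1))
  have h1 : (1 : ℝ) ≤ n0 := by exact_mod_cast (hn0 n0 le_rfl).2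
  have key : ∀ n, n0 ≤ n → b n ≤ b n0 / (n0 : ℝ) ^ η * (n : ℝ) ^ η := by
    intro n hn
    induction n, hn using Nat.le_induction with
    | base => rw [div_mul_cancel₀ _ (by positivity)]
    | succ n hn ih =>
      have hn1 : (1 : ℝ) ≤ n := by exact_mod_cast (hn0 n hn).2
      have hd : 0 ≤ η / ((n : ℝ) + 1) := by positivity
      refine ((hn0 n hn).1.trans (mul_le_mul_of_nonneg_left ih (by positivity))).trans ?_
      have h2 := div_add_one_rpow_le hη hη1 (n := n)
      rw [Real.div_rpow (by positivity) (by positivity), div_le_iff₀ (by positivity)] at h2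
      -- This is `(1 + u) (1 - u) ≤ 1` with `u = η / (n + 1)`.
      have h3 : (1 + η / ((n : ℝ) + 1)) * (n : ℝ) ^ η ≤ ((n : ℝ) + 1) ^ η := by
        have h4 := mul_le_mul_of_nonneg_left h2 (by positivity : 0 ≤ 1 + η / ((n : ℝ) + 1))
        have h5 : 0 < ((n : ℝ) + 1) ^ η := by positivity
        nlinarith [mul_nonneg (mul_nonneg hd hd) h5.le]
      have h6 : 0 ≤ b n0 / (n0 : ℝ) ^ η := div_nonneg (hb _) (by positivity)
      push_cast
      nlinarith [mul_le_mul_of_nonneg_left h3 h6]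
  refine IsBigO.of_bound (b n0 / (n0 : ℝ) ^ η) ?_
  filter_upwards [eventually_ge_atTop n0] with n hn
  rw [Real.norm_of_nonneg (hb n), Real.norm_of_nonneg (by positivity)]
  exact key n hn

/-! ### Perturbed linear recursions -/

/-- The increments of the rescaled solution of a perturbed linear recursion, corrected by the
noise. -/
theorem rescaled_increment {γ : ℝ} {e g ε N : ℕ → ℝ} {n : ℕ}
    (he : e (n + 1) = (1 - γ / (n + 1)) * e n - 1 / ((n : ℝ) + 1) * (g n + ε (n + 1)))
    (hN : N (n + 1) = N n - ((n : ℝ) + 1) ^ (γ - 1) * ε (n + 1)) :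
    (((n + 1 : ℕ) : ℝ) ^ γ * e (n + 1) - N (n + 1)) - ((n : ℝ) ^ γ * e n - N n)
      = (((n : ℝ) + 1) ^ γ * (1 - γ / (n + 1)) - (n : ℝ) ^ γ) * e n
        - ((n : ℝ) + 1) ^ (γ - 1) * g n := by
  have h1 : ((n : ℝ) + 1) ^ (γ - 1) = ((n : ℝ) + 1) ^ γ * (1 / ((n : ℝ) + 1)) := by
    rw [Real.rpow_sub_one (by positivity)]; ring
  rw [he, hN, h1]
  push_cast
  ring

/-- A priori bound: solutions of a recursion with sublinear perturbation decay almost as fast as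
`n ^ (-γ)`. -/
theorem isBigO_of_sublinear {γ : ℝ} (hγ : 0 < γ) (hγ1 : γ ≤ 1) {x g ε N : ℕ → ℝ}
    (hx : ∀ n : ℕ, 1 ≤ n →
      x (n + 1) = (1 - γ / (n + 1)) * x n - 1 / ((n : ℝ) + 1) * (g n + ε (n + 1)))
    (hN : ∀ n : ℕ, 1 ≤ n → N (n + 1) = N n - ((n : ℝ) + 1) ^ (γ - 1) * ε (n + 1))
    (hN0 : Tendsto N atTop (𝓝 0)) (hg : g =o[atTop] x) {η : ℝ} (hη : 0 < η) (hη1 : η ≤ 1) :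
    x =O[atTop] fun n : ℕ => (n : ℝ) ^ (η - γ) := by
  obtain ⟨K, hK⟩ := hN0.norm.bddAbove_range
  have hNK : ∀ n, |N n| ≤ K := fun n => hK ⟨n, rfl⟩
  have hK0 : 0 ≤ K := (abs_nonneg _).trans (hNK 0)
  set w : ℕ → ℝ := fun n => (n : ℝ) ^ γ * x n - N n with hw
  have hcoef : (fun n : ℕ => ((n : ℝ) + 1) ^ γ * (1 - γ / (n + 1)) - (n : ℝ) ^ γ)
      =o[atTop] fun n : ℕ => (n : ℝ) ^ (γ - 1) :=
    (add_one_rpow_mul_sub_isBigO hγ.le hγ1).trans_isLittleO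
      (natCast_rpow_isLittleO (by linarith))
  have hterm1 := hcoef.mul_isBigO (isBigO_refl x atTop)
  have hterm2 := (natCast_add_one_rpow_isBigO (γ - 1)).mul_isLittleO hg
  have hinc : (fun n => w (n + 1) - w n) =o[atTop] fun n : ℕ => (n : ℝ) ^ (γ - 1) * x n := by
    refine (hterm1.sub hterm2).congr' ?_ EventuallyEq.rfl
    filter_upwards [eventually_ge_atTop 1] with n hn
    exact (rescaled_increment (hx n hn) (hN n hn)).symm
  -- Adding `K` makes the quantity dominate `n ^ γ * |x n|`, so the increment bound closes up into a
  -- Gronwall inequality.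
  have hb : (fun n => |w n| + K) =O[atTop] fun n : ℕ => (n : ℝ) ^ η := by
    refine isBigO_of_le_one_add_div_mul hη.le hη1 (fun n => by positivity) ?_
    filter_upwards [isLittleO_iff.1 hinc (half_pos hη), eventually_ge_atTop 1] with n h1 hn
    have hn1 : (1 : ℝ) ≤ n := by exact_mod_cast hn
    have h2 : ‖(n : ℝ) ^ (γ - 1) * x n‖ = 1 / n * |(n : ℝ) ^ γ * x n| := by
      rw [Real.rpow_sub_one (by positivity), Real.norm_eq_abs, abs_mul, abs_mul, abs_div,
        abs_of_nonneg (by positivity : (0 : ℝ) ≤ n)]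
      ring
    have h3 : |(n : ℝ) ^ γ * x n| ≤ |w n| + K := by
      have : (n : ℝ) ^ γ * x n = w n + N n := by simp [hw]
      rw [this]
      exact (abs_add_le _ _).trans (add_le_add le_rfl (hNK n))
    have h4 : |w (n + 1)| ≤ |w n| + |w (n + 1) - w n| := by
      have := abs_add_le (w n) (w (n + 1) - w n)
      simpa using this
    have h5 : η / 2 * (1 / n) ≤ η / ((n : ℝ) + 1) := by
      rw [div_mul_div_comm, mul_one, div_le_div_iff₀ (by positivity) (by positivity)]
      nlinarith
    rw [h2, Real.norm_eq_abs] at h1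
    have h6 : |w (n + 1) - w n| ≤ η / (n + 1) * (|w n| + K) :=
      calc |w (n + 1) - w n| ≤ η / 2 * (1 / n * |(n : ℝ) ^ γ * x n|) := h1
        _ = η / 2 * (1 / n) * |(n : ℝ) ^ γ * x n| := by ring
        _ ≤ η / (n + 1) * (|w n| + K) := by gcongr
    linarith
  have hv : (fun n : ℕ => (n : ℝ) ^ γ * x n) =O[atTop] fun n : ℕ => (n : ℝ) ^ η := by
    refine (IsBigO.of_bound 1 (Eventually.of_forall fun n => ?_)).trans hb
    rw [Real.norm_eq_abs, one_mul, Real.norm_of_nonneg (by positivity)]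
    have : (n : ℝ) ^ γ * x n = w n + N n := by simp [hw]
    rw [this]
    exact (abs_add_le _ _).trans (add_le_add le_rfl (hNK n))
  refine ((natCast_rpow_isBigO (le_refl (-γ))).mul_natCast_rpow hv (c := η - γ)
    (by linarith)).congr' ?_ EventuallyEq.rfl
  filter_upwards [eventually_gt_atTop 0] with n hn
  have hn0 : (0 : ℝ) < n := by exact_mod_cast hn
  rw [← mul_assoc, ← Real.rpow_add hn0]
  simp

/-- The rescaled solution of a recursion with a perturbation of order `1 + δ` converges. -/
theorem exists_tendsto_rescaled {γ : ℝ} (hγ : 0 < γ) (hγ1 : γ ≤ 1) {x g ε N : ℕ → ℝ}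
    (hx : ∀ n : ℕ, 1 ≤ n →
      x (n + 1) = (1 - γ / (n + 1)) * x n - 1 / ((n : ℝ) + 1) * (g n + ε (n + 1)))
    (hN : ∀ n : ℕ, 1 ≤ n → N (n + 1) = N n - ((n : ℝ) + 1) ^ (γ - 1) * ε (n + 1))
    (hN0 : Tendsto N atTop (𝓝 0)) (hx0 : Tendsto x atTop (𝓝 0)) {δ : ℝ} (hδ : 0 < δ)
    (hg : g =O[atTop] fun n => |x n| ^ (1 + δ)) :
    ∃ Z, Tendsto (fun n : ℕ => (n : ℝ) ^ γ * x n) atTop (𝓝 Z) := by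
  have hgx : g =o[atTop] x := by
    refine hg.trans_isLittleO ?_
    have h1 : Tendsto (fun n => |x n| ^ δ) atTop (𝓝 0) := by
      have := hx0.abs.rpow_const (p := δ) (Or.inr hδ.le)
      simpa [Real.zero_rpow hδ.ne'] using this
    have h2 := ((isLittleO_one_iff ℝ).2 h1).mul_isBigO (isBigO_refl x atTop).abs_left
    refine h2.congr (fun n => ?_) fun n => one_mul _
    rcases (abs_nonneg (x n)).eq_or_lt with h0 | h0
    · rw [← h0, mul_zero, Real.zero_rpow (by linarith)]
    · rw [Real.rpow_add h0, Real.rpow_one, mul_comm]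
  -- The choice gives `γ - 1 + (η - γ) (1 + δ) ≤ -1 - γ δ / 2` and `η - 2 ≤ -3/2`, so both parts of
  -- the increment are summable.
  set η : ℝ := min (1 / 2) (γ * δ / (2 * (1 + δ))) with hη
  have hη0 : 0 < η := lt_min (by norm_num) (by positivity)
  have hη1 : η ≤ 1 / 2 := min_le_left _ _
  have hη2 : η * (1 + δ) ≤ γ * δ / 2 := by
    have h1 : η ≤ γ * δ / (2 * (1 + δ)) := min_le_right _ _
    rw [le_div_iff₀ (by positivity)] at h1
    linarith
  have hxO := isBigO_of_sublinear hγ hγ1 hx hN hN0 hgx hη0 (by linarith)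
  have hgO : g =O[atTop] fun n : ℕ => (n : ℝ) ^ ((η - γ) * (1 + δ)) := by
    refine hg.trans ((hxO.abs_left.rpow (r := 1 + δ) (by linarith)
      (Eventually.of_forall fun n => by positivity)).congr_right fun n => ?_)
    rw [← Real.rpow_mul (by positivity)]
  set w : ℕ → ℝ := fun n => (n : ℝ) ^ γ * x n - N n with hw
  have hγδ : 0 < γ * δ := by positivity
  have h1 : (fun n : ℕ => (((n : ℝ) + 1) ^ γ * (1 - γ / (n + 1)) - (n : ℝ) ^ γ) * x n)
      =O[atTop] fun n : ℕ => (n : ℝ) ^ (-3 / 2 : ℝ) :=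
    (add_one_rpow_mul_sub_isBigO hγ.le hγ1).mul_natCast_rpow hxO (by linarith)
  have h2 : (fun n : ℕ => ((n : ℝ) + 1) ^ (γ - 1) * g n)
      =O[atTop] fun n : ℕ => (n : ℝ) ^ (-1 - γ * δ / 2) :=
    (natCast_add_one_rpow_isBigO _).mul_natCast_rpow hgO (by nlinarith)
  have hs1 := summable_of_isBigO_nat (Real.summable_nat_rpow.2 (by norm_num)) h1
  have hs2 := summable_of_isBigO_nat (Real.summable_nat_rpow.2 (by linarith)) h2
  have hsum : Summable fun n => w (n + 1) - w n := by
    refine (summable_nat_add_iff 1).1 (((summable_nat_add_iff 1).2 (hs1.sub hs2)).congr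
      fun n => ?_)
    exact (rescaled_increment (hx (n + 1) (by omega)) (hN (n + 1) (by omega))).symm
  have hlim := hsum.hasSum.tendsto_sum_nat
  simp_rw [Finset.sum_range_sub] at hlim
  have := (hlim.add_const (w 0)).add hN0
  exact ⟨_, this.congr fun n => by simp [hw]⟩

/-- If the perturbation of the linear recursion is expanded to order `m + 1`, then so is the
solution. -/
theorem expansion_succ {γ : ℝ} (hγ : 0 < γ) {x R ε N : ℕ → ℝ}
    (hx : ∀ n : ℕ, 1 ≤ n →
      x (n + 1) = (1 - γ / (n + 1)) * x n - 1 / ((n : ℝ) + 1) * (R n + ε (n + 1)))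
    (hN : ∀ n : ℕ, 1 ≤ n → N (n + 1) = N n - ((n : ℝ) + 1) ^ (γ - 1) * ε (n + 1))
    {m : ℕ} (hm : 1 ≤ m) (hmγ : ((m : ℝ) + 1) * γ < 1 / 2)
    (hNo : N =o[atTop] fun n : ℕ => (n : ℝ) ^ (-(m * γ))) {Z : ℝ} {b : ℕ → ℝ} (hb : b 1 = 1)
    (hZ : Tendsto (fun n : ℕ => (n : ℝ) ^ γ * x n) atTop (𝓝 Z))
    (hR : (fun n : ℕ => R n - ∑ t ∈ Finset.Icc 2 (m + 1),
        γ * ((t : ℝ) - 1) * b t * (Z * (n : ℝ) ^ (-γ)) ^ t)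
      =o[atTop] fun n : ℕ => ((n : ℝ) ^ (-γ)) ^ (m + 1)) :
    (fun n : ℕ => x n - ∑ j ∈ Finset.Icc 1 (m + 1), b j * (Z * (n : ℝ) ^ (-γ)) ^ j)
      =o[atTop] fun n : ℕ => ((n : ℝ) ^ (-γ)) ^ (m + 1) := by
  have hpow : ∀ (n j : ℕ), ((n : ℝ) ^ (-γ)) ^ j = (n : ℝ) ^ (-(j * γ)) := fun n j => by
    rw [← Real.rpow_mul_natCast (by positivity)]; congr 1; ring
  have hm1 : (1 : ℝ) ≤ m := by exact_mod_cast hm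
  have hmγ0 : 0 < m * γ := by positivity
  simp only [mul_pow, hpow] at hR ⊢
  set B : ℕ → ℝ := fun n => ∑ j ∈ Finset.Icc 1 (m + 1), b j * (Z ^ j * (n : ℝ) ^ (-(j * γ)))
    with hB
  set e : ℕ → ℝ := fun n => x n - B n with he
  -- The perturbation for which `e = x - B` solves the same linear recursion with the same noise.
  set g : ℕ → ℝ := fun n => R n + ((n : ℝ) + 1) * (B (n + 1) - (1 - γ / (n + 1)) * B n) with hg
  have hrec : ∀ n : ℕ, 1 ≤ n →
      e (n + 1) = (1 - γ / (n + 1)) * e n - 1 / ((n : ℝ) + 1) * (g n + ε (n + 1)) := by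
    intro n hn
    have : (n : ℝ) + 1 ≠ 0 := by positivity
    simp only [he, hg, hx n hn]
    field_simp
    ring
  have hjγ : ∀ j ∈ Finset.Icc 1 (m + 1), (j : ℝ) * γ ≤ 1 ∧ γ ≤ j * γ := by
    intro j hj
    obtain ⟨h1, h2⟩ := Finset.mem_Icc.1 hj
    have h1' : (1 : ℝ) ≤ j := by exact_mod_cast h1
    have h2' : (j : ℝ) ≤ m + 1 := by exact_mod_cast h2
    constructor <;> nlinarith
  -- To leading order the `j`-th monomial of `B` contributes `-γ (j - 1) b_j z ^ j` to `g`,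
  -- cancelling the expansion of `R`; what is left is `O(n ^ (-1 - j γ))` per monomial, negligible
  -- as `(m + 1) γ < 1`.
  have hgo : g =o[atTop] fun n : ℕ => (n : ℝ) ^ (-(((m + 1 : ℕ) : ℝ) * γ)) := by
    have hstep : (fun n : ℕ => ∑ j ∈ Finset.Icc 1 (m + 1), b j * Z ^ j * (((n : ℝ) + 1) *
        (((n : ℝ) + 1) ^ (-(j * γ)) - (1 - j * γ / (n + 1)) * (n : ℝ) ^ (-(j * γ)))))
        =o[atTop] fun n : ℕ => (n : ℝ) ^ (-(((m + 1 : ℕ) : ℝ) * γ)) := by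
      refine IsLittleO.fun_sum fun j hj => IsLittleO.const_mul_left ?_ _
      obtain ⟨h1, h2⟩ := hjγ j hj
      refine natCast_add_one_isBigO.mul_natCast_rpow_of_lt
        (add_one_rpow_neg_sub_isBigO (by linarith) h1) ?_
      push_cast
      linarith
    refine (hR.add hstep).congr_left fun n => ?_
    have hIcc : Finset.Icc 1 (m + 1) = insert 1 (Finset.Icc 2 (m + 1)) := by
      ext i; simp only [Finset.mem_insert, Finset.mem_Icc]; omega
    have h1 : ∑ t ∈ Finset.Icc 2 (m + 1),
        γ * ((t : ℝ) - 1) * b t * (Z ^ t * (n : ℝ) ^ (-(t * γ)))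
        = ∑ t ∈ Finset.Icc 1 (m + 1),
          γ * ((t : ℝ) - 1) * b t * (Z ^ t * (n : ℝ) ^ (-(t * γ))) := by
      rw [hIcc, Finset.sum_insert (by simp)]
      simp
    have hn1 : (n : ℝ) + 1 ≠ 0 := by positivity
    simp only [hg, hB]
    rw [h1, sub_add, sub_eq_add_neg, ← Finset.sum_sub_distrib, Finset.mul_sum,
      ← Finset.sum_sub_distrib, Finset.mul_sum, ← Finset.sum_neg_distrib]
    congr 1
    refine Finset.sum_congr rfl fun j _ => ?_
    push_cast
    field_simp
    ring
  -- Only `j = 1` survives the rescaling, and `b 1 = 1`; this fixes the constant of integration as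
  -- `Z`.
  have hvB : Tendsto (fun n : ℕ => (n : ℝ) ^ γ * e n) atTop (𝓝 0) := by
    have h1 : Tendsto (fun n : ℕ => (n : ℝ) ^ γ * B n) atTop (𝓝 Z) := by
      have h2 : Tendsto (fun n : ℕ => ∑ j ∈ Finset.Icc 1 (m + 1),
          b j * (Z ^ j * (n : ℝ) ^ (γ + -(j * γ)))) atTop
          (𝓝 (∑ j ∈ Finset.Icc 1 (m + 1), if j = 1 then Z else 0)) := by
        refine tendsto_finsetSum _ fun j hj => ?_
        split_ifs with h
        · subst h; simp [hb]
        · have hj2 : (2 : ℝ) ≤ j := by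
            have := (Finset.mem_Icc.1 hj).1
            exact_mod_cast (by omega : 2 ≤ j)
          have h3 : Tendsto (fun n : ℕ => (n : ℝ) ^ (-((j : ℝ) * γ - γ))) atTop (𝓝 0) :=
            (tendsto_rpow_neg_atTop (by nlinarith)).comp tendsto_natCast_atTop_atTop
          have h4 := (h3.const_mul (Z ^ j)).const_mul (b j)
          simp only [mul_zero] at h4
          refine h4.congr fun n => ?_
          congr 3
          ring
      rw [Finset.sum_ite_eq' _ 1 (fun _ => Z), if_pos (by simp)] at h2
      refine h2.congr' ?_
      filter_upwards [eventually_gt_atTop 0] with n hn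
      have hn0 : (0 : ℝ) < n := by exact_mod_cast hn
      simp only [hB, Finset.mul_sum]
      refine Finset.sum_congr rfl fun j _ => ?_
      rw [Real.rpow_add hn0]
      ring
    have := hZ.sub h1
    rw [sub_self] at this
    exact this.congr fun n => by simp only [he]; ring
  have hN0 : Tendsto N atTop (𝓝 0) := hNo.trans_tendsto
    ((tendsto_rpow_neg_atTop hmγ0).comp tendsto_natCast_atTop_atTop)
  have heO : e =O[atTop] fun n : ℕ => (n : ℝ) ^ (-γ) := by
    have h1 := (natCast_rpow_isBigO (le_refl (-γ))).mul (hvB.isBigO_one ℝ)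
    refine h1.congr' ?_ (Eventually.of_forall fun n => mul_one _)
    filter_upwards [eventually_gt_atTop 0] with n hn
    have hn0 : (0 : ℝ) < n := by exact_mod_cast hn
    rw [← mul_assoc, ← Real.rpow_add hn0]
    simp
  have hinc : (fun n : ℕ => (((n + 1 : ℕ) : ℝ) ^ γ * e (n + 1) - N (n + 1))
      - ((n : ℝ) ^ γ * e n - N n)) =o[atTop] fun n : ℕ => (n : ℝ) ^ (-1 - m * γ) := by
    have h1 : (fun n : ℕ => (((n : ℝ) + 1) ^ γ * (1 - γ / (n + 1)) - (n : ℝ) ^ γ) * e n)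
        =o[atTop] fun n : ℕ => (n : ℝ) ^ (-1 - m * γ) :=
      (add_one_rpow_mul_sub_isBigO hγ.le (by nlinarith)).mul_natCast_rpow_of_lt heO
        (by nlinarith)
    have h2 : (fun n : ℕ => ((n : ℝ) + 1) ^ (γ - 1) * g n)
        =o[atTop] fun n : ℕ => (n : ℝ) ^ (-1 - m * γ) :=
      (natCast_add_one_rpow_isBigO _).mul_isLittleO_natCast_rpow hgo
        (le_of_eq (by push_cast; ring))
    refine (h1.sub h2).congr' ?_ EventuallyEq.rfl
    filter_upwards [eventually_ge_atTop 1] with n hn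
    exact (rescaled_increment (hrec n hn) (hN n hn)).symm
  have hw := isLittleO_of_increments (h := fun n : ℕ => (n : ℝ) ^ γ * e n - N n) hmγ0
    (by nlinarith) (by simpa using hvB.sub hN0) hinc
  -- The noise tail re-enters here, and its size limits the attainable order.
  have hv : (fun n : ℕ => (n : ℝ) ^ γ * e n) =o[atTop] fun n : ℕ => (n : ℝ) ^ (-(m * γ)) :=
    (hw.add hNo).congr_left fun n => by ring
  refine ((natCast_rpow_isBigO (le_refl (-γ))).mul_isLittleO_natCast_rpow hv
    (le_of_eq (by push_cast; ring))).congr' ?_ EventuallyEq.rfl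
  filter_upwards [eventually_gt_atTop 0] with n hn
  have hn0 : (0 : ℝ) < n := by exact_mod_cast hn
  rw [← mul_assoc, ← Real.rpow_add hn0]
  simp

/-- Expansion of the weighted tail sums of a sequence which has an expansion in powers of
`n ^ (-γ)`. -/
theorem tsum_tail_expansion {γ : ℝ} (hγ : 0 < γ) {k : ℕ} (hk : 2 ≤ k)
    (hkγ : ((k : ℝ) - 1) * γ < 1 / 2) {R r : ℕ → ℝ} {Z : ℝ} {b : ℕ → ℝ}
    (hr : r =O[atTop] fun j : ℕ => 1 / (j : ℝ))
    (hR : (fun n : ℕ => R n - ∑ t ∈ Finset.Icc 2 k,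
        γ * ((t : ℝ) - 1) * b t * (Z * (n : ℝ) ^ (-γ)) ^ t)
      =o[atTop] fun n : ℕ => ((n : ℝ) ^ (-γ)) ^ k) :
    Summable (fun j : ℕ => 1 / ((j : ℝ) + 1) ^ (1 - γ) * (1 + r j) * R j) ∧
    (fun n : ℕ => (n : ℝ) ^ (((k : ℝ) - 1) * γ) *
          ∑' j, 1 / (((n + j : ℕ) : ℝ) + 1) ^ (1 - γ) * (1 + r (n + j)) * R (n + j) -
        ∑ t ∈ Finset.Icc 2 k, (n : ℝ) ^ (((k : ℝ) - t) * γ) * b t * Z ^ t)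
      =o[atTop] fun _ => (1 : ℝ) := by
  have hpow : ∀ (n j : ℕ), ((n : ℝ) ^ (-γ)) ^ j = (n : ℝ) ^ (-(j * γ)) := fun n j => by
    rw [← Real.rpow_mul_natCast (by positivity)]; congr 1; ring
  have hk2 : (2 : ℝ) ≤ k := by exact_mod_cast hk
  have hγ2 : γ < 1 / 2 := by nlinarith
  simp only [mul_pow, hpow] at hR
  set c : ℕ → ℝ := fun j => 1 / ((j : ℝ) + 1) ^ (1 - γ) * (1 + r j) * R j with hc
  have hr' : r =O[atTop] fun n : ℕ => (n : ℝ) ^ (-1 : ℝ) := by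
    refine hr.congr_right fun n => ?_
    rw [Real.rpow_neg_one, one_div]
  have hRO : R =O[atTop] fun n : ℕ => (n : ℝ) ^ (-(2 * γ)) := by
    have h1 : (fun n : ℕ => ∑ t ∈ Finset.Icc 2 k,
        γ * ((t : ℝ) - 1) * b t * (Z ^ t * (n : ℝ) ^ (-(t * γ))))
        =O[atTop] fun n : ℕ => (n : ℝ) ^ (-(2 * γ)) := by
      refine IsBigO.fun_sum fun t ht => ((natCast_rpow_isBigO ?_).const_mul_left _).const_mul_left _
      have : (2 : ℝ) ≤ t := by exact_mod_cast (Finset.mem_Icc.1 ht).1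
      nlinarith
    refine ((hR.isBigO.trans (natCast_rpow_isBigO (by nlinarith))).add h1).congr_left
      fun n => by ring
  have hweight : ∀ n : ℕ, 1 / ((n : ℝ) + 1) ^ (1 - γ) = ((n : ℝ) + 1) ^ (γ - 1) := fun n => by
    rw [one_div, ← Real.rpow_neg (by positivity), neg_sub]
  have hW := natCast_add_one_rpow_isBigO (γ - 1)
  have hWR : (fun n : ℕ => ((n : ℝ) + 1) ^ (γ - 1) * R n)
      =O[atTop] fun n : ℕ => (n : ℝ) ^ (-1 - γ) := hW.mul_natCast_rpow hRO (by linarith)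
  have hWRr : (fun n : ℕ => ((n : ℝ) + 1) ^ (γ - 1) * R n * r n)
      =O[atTop] fun n : ℕ => (n : ℝ) ^ (-2 - γ) := hWR.mul_natCast_rpow hr' (by linarith)
  have hce : ∀ n, c n = ((n : ℝ) + 1) ^ (γ - 1) * R n + ((n : ℝ) + 1) ^ (γ - 1) * R n * r n :=
    fun n => by simp only [hc, hweight]; ring
  have hcsum : Summable c := by
    refine summable_of_isBigO_nat (Real.summable_nat_rpow.2 (by linarith : -1 - γ < -1)) ?_
    exact (hWR.add (hWRr.trans (natCast_rpow_isBigO (by linarith)))).congr_left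
      fun n => (hce n).symm
  refine ⟨hcsum, ?_⟩
  set A : ℕ → ℝ := fun n => ∑' j, c (n + j) with hA
  have hAsucc : ∀ n, A (n + 1) - A n = -c n := by
    intro n
    have hs : Summable fun j => c (n + j) := by
      simpa [add_comm] using (summable_nat_add_iff n).2 hcsum
    have := hs.tsum_eq_zero_add
    simp only [hA, this, add_zero]
    have e : ∀ j, c (n + 1 + j) = c (n + (j + 1)) := fun j => by congr 1; omega
    simp_rw [e]
    ring
  have hA0 : Tendsto A atTop (𝓝 0) := by
    have := tendsto_sum_nat_add c
    exact this.congr fun n => by simp only [hA, add_comm]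
  set p : ℝ := ((k : ℝ) - 1) * γ with hp
  have hp0 : 0 < p := mul_pos (by linarith) hγ
  -- Both `A` and the candidate tend to `0`, so comparing increments suffices.
  set h : ℕ → ℝ := fun n => A n - ∑ t ∈ Finset.Icc 2 k,
    b t * Z ^ t * (n : ℝ) ^ (-(((t : ℝ) - 1) * γ)) with hh
  have ht2 : ∀ t ∈ Finset.Icc 2 k, (2 : ℝ) ≤ t ∧ (t : ℝ) ≤ k := fun t ht =>
    ⟨by exact_mod_cast (Finset.mem_Icc.1 ht).1, by exact_mod_cast (Finset.mem_Icc.1 ht).2⟩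
  have hh0 : Tendsto h atTop (𝓝 0) := by
    have h1 : Tendsto (fun n : ℕ => ∑ t ∈ Finset.Icc 2 k,
        b t * Z ^ t * (n : ℝ) ^ (-(((t : ℝ) - 1) * γ))) atTop
        (𝓝 (∑ t ∈ Finset.Icc 2 k, b t * Z ^ t * 0)) := by
      refine tendsto_finsetSum _ fun t ht => Tendsto.const_mul _ ?_
      exact (tendsto_rpow_neg_atTop (mul_pos (by linarith [(ht2 t ht).1]) hγ)).comp
        tendsto_natCast_atTop_atTop
    simpa using hA0.sub h1
  have hdiffγ : (fun n : ℕ => (n : ℝ) ^ γ - ((n : ℝ) + 1) ^ γ)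
      =O[atTop] fun n : ℕ => (n : ℝ) ^ (γ - 1) := by
    have h1 := (add_one_rpow_mul_sub_isBigO hγ.le (by linarith)).trans
      (natCast_rpow_isBigO (by linarith : γ - 2 ≤ γ - 1))
    have h2 := ((natCast_add_one_rpow_isBigO γ).mul_natCast_rpow one_div_natCast_add_one_isBigO
      (le_of_eq (by ring) : γ + -1 ≤ γ - 1)).const_mul_left γ
    refine (h1.add h2).neg_left.congr_left fun n => ?_
    ring
  -- Four errors: the remainder of `R`, the factor `1 + r`, the discrete derivative of each power,
  -- and `(n + 1) ^ γ` in place of `n ^ γ` in the weight.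
  have hinc : (fun n => h (n + 1) - h n) =o[atTop] fun n : ℕ => (n : ℝ) ^ (-1 - p) := by
    have h1 := hW.mul_isLittleO_natCast_rpow hR
      (le_of_eq (by rw [hp]; ring) : γ - 1 + -(k * γ) ≤ -1 - p)
    have h2 : (fun n : ℕ => ((n : ℝ) + 1) ^ (γ - 1) * R n * r n)
        =o[atTop] fun n : ℕ => (n : ℝ) ^ (-1 - p) :=
      hWRr.trans_isLittleO (natCast_rpow_isLittleO (by linarith))
    have h3 : (fun n : ℕ => ∑ t ∈ Finset.Icc 2 k, b t * Z ^ t *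
        (((n : ℝ) + 1) ^ (-(((t : ℝ) - 1) * γ))
          - (1 - ((t : ℝ) - 1) * γ / (n + 1)) * (n : ℝ) ^ (-(((t : ℝ) - 1) * γ))))
        =o[atTop] fun n : ℕ => (n : ℝ) ^ (-1 - p) := by
      refine IsLittleO.fun_sum fun t ht => IsLittleO.const_mul_left ?_ _
      obtain ⟨h4, h5⟩ := ht2 t ht
      refine (add_one_rpow_neg_sub_isBigO (mul_nonneg (by linarith) hγ.le)
        (by nlinarith)).trans_isLittleO (natCast_rpow_isLittleO ?_)
      nlinarith
    have h4 : (fun n : ℕ => ∑ t ∈ Finset.Icc 2 k, b t * Z ^ t * (γ * ((t : ℝ) - 1)) *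
        (1 / ((n : ℝ) + 1) * ((n : ℝ) ^ (-(t * γ)) * ((n : ℝ) ^ γ - ((n : ℝ) + 1) ^ γ))))
        =o[atTop] fun n : ℕ => (n : ℝ) ^ (-1 - p) := by
      refine IsLittleO.fun_sum fun t ht => IsLittleO.const_mul_left ?_ _
      obtain ⟨h4, h5⟩ := ht2 t ht
      refine one_div_natCast_add_one_isBigO.mul_natCast_rpow_of_lt
        ((natCast_rpow_isBigO le_rfl).mul_natCast_rpow hdiffγ le_rfl) ?_
      nlinarith
    refine (((h1.add h2).add h3).neg_left.add h4).congr' ?_ EventuallyEq.rfl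
    filter_upwards [eventually_gt_atTop 0] with n hn
    have hn0 : (0 : ℝ) < n := by exact_mod_cast hn
    have e1 : h (n + 1) - h n = -c n - (∑ t ∈ Finset.Icc 2 k,
        b t * Z ^ t * (((n + 1 : ℕ) : ℝ) ^ (-(((t : ℝ) - 1) * γ))
          - (n : ℝ) ^ (-(((t : ℝ) - 1) * γ)))) := by
      rw [← hAsucc]
      simp only [hh, mul_sub, Finset.sum_sub_distrib]
      ring
    have e2 : ((n : ℝ) + 1) ^ (γ - 1) = ((n : ℝ) + 1) ^ γ * (1 / ((n : ℝ) + 1)) := by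
      rw [Real.rpow_sub_one (by positivity)]; ring
    have e3 : ∀ t : ℕ, (n : ℝ) ^ (-(((t : ℝ) - 1) * γ)) = (n : ℝ) ^ (-(t * γ)) * (n : ℝ) ^ γ :=
      fun t => by rw [← Real.rpow_add hn0]; congr 1; ring
    have e4 : ∑ t ∈ Finset.Icc 2 k, b t * Z ^ t * (γ * ((t : ℝ) - 1)) *
        (1 / ((n : ℝ) + 1) * ((n : ℝ) ^ (-(t * γ)) * ((n : ℝ) ^ γ - ((n : ℝ) + 1) ^ γ)))
        = ∑ t ∈ Finset.Icc 2 k, b t * Z ^ t *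
          (((t : ℝ) - 1) * γ / (n + 1) * (n : ℝ) ^ (-(((t : ℝ) - 1) * γ)))
        - ((n : ℝ) + 1) ^ (γ - 1) * ∑ t ∈ Finset.Icc 2 k,
          γ * ((t : ℝ) - 1) * b t * (Z ^ t * (n : ℝ) ^ (-(t * γ))) := by
      rw [Finset.mul_sum, ← Finset.sum_sub_distrib]
      refine Finset.sum_congr rfl fun t _ => ?_
      rw [e2, e3]
      ring
    have e5 : ∑ t ∈ Finset.Icc 2 k, b t * Z ^ t *
        (((n : ℝ) + 1) ^ (-(((t : ℝ) - 1) * γ))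
          - (1 - ((t : ℝ) - 1) * γ / (n + 1)) * (n : ℝ) ^ (-(((t : ℝ) - 1) * γ)))
        = ∑ t ∈ Finset.Icc 2 k, b t * Z ^ t * (((n + 1 : ℕ) : ℝ) ^ (-(((t : ℝ) - 1) * γ))
          - (n : ℝ) ^ (-(((t : ℝ) - 1) * γ)))
        + ∑ t ∈ Finset.Icc 2 k, b t * Z ^ t *
          (((t : ℝ) - 1) * γ / (n + 1) * (n : ℝ) ^ (-(((t : ℝ) - 1) * γ))) := by
      rw [← Finset.sum_add_distrib]
      refine Finset.sum_congr rfl fun t _ => ?_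
      push_cast
      ring
    rw [e1, hce, e4, e5]
    ring
  have hfin := isLittleO_of_increments hp0 (by linarith) hh0 hinc
  refine ((natCast_rpow_isBigO (le_refl p)).mul_isLittleO hfin).congr' ?_ ?_
  · filter_upwards [eventually_gt_atTop 0] with n hn
    have hn0 : (0 : ℝ) < n := by exact_mod_cast hn
    simp only [hh, mul_sub]
    congr 1
    rw [Finset.mul_sum]
    refine Finset.sum_congr rfl fun t _ => ?_
    have e : (n : ℝ) ^ (((k : ℝ) - t) * γ) = (n : ℝ) ^ p * (n : ℝ) ^ (-(((t : ℝ) - 1) * γ)) := by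
      rw [← Real.rpow_add hn0, hp]; congr 1; ring
    rw [e]
    ring
  · filter_upwards [eventually_gt_atTop 0] with n hn
    have hn0 : (0 : ℝ) < n := by exact_mod_cast hn
    rw [← Real.rpow_add hn0]
    simp

/-- The expansion of a solution of the recursion to every admissible order `m`, together with the
expansion of its perturbation to order `m + 1`. -/
theorem expansion_of_recursion {d : ℕ → ℝ} (hd : 0 < d 1) {k : ℕ} {x R ε : ℕ → ℝ}
    (hx : ∀ n : ℕ, 1 ≤ n →
      x (n + 1) = (1 - d 1 / (n + 1)) * x n - 1 / ((n : ℝ) + 1) * (R n + ε (n + 1)))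
    (hR : ∀ m, 1 ≤ m → m ≤ k →
      (fun n => R n - ∑ i ∈ Finset.Icc 2 m, d i / (Nat.factorial i : ℝ) * x n ^ i)
        =o[atTop] fun n => x n ^ m)
    (hnoise : ∀ m : ℕ, 1 ≤ m → ((m : ℝ) + 1) * d 1 < 1 / 2 → ∃ N : ℕ → ℝ,
      (∀ n : ℕ, 1 ≤ n → N (n + 1) = N n - ((n : ℝ) + 1) ^ (d 1 - 1) * ε (n + 1)) ∧
      N =o[atTop] fun n : ℕ => (n : ℝ) ^ (-(m * d 1)))
    {Z : ℝ} (hZ : Tendsto (fun n : ℕ => (n : ℝ) ^ d 1 * x n) atTop (𝓝 Z))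
    {m : ℕ} (hm : 1 ≤ m) (hmk : m ≤ k) (hmγ : m * d 1 < 1 / 2) :
    (fun n : ℕ => x n - ∑ j ∈ Finset.Icc 1 m, expansionCoeff d j * (Z * (n : ℝ) ^ (-d 1)) ^ j)
      =o[atTop] (fun n : ℕ => ((n : ℝ) ^ (-d 1)) ^ m) ∧
    (m + 1 ≤ k → (fun n : ℕ => R n - ∑ t ∈ Finset.Icc 2 (m + 1),
        d 1 * ((t : ℝ) - 1) * expansionCoeff d t * (Z * (n : ℝ) ^ (-d 1)) ^ t)
      =o[atTop] fun n : ℕ => ((n : ℝ) ^ (-d 1)) ^ (m + 1)) := by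
  have hq : Tendsto (fun n : ℕ => (n : ℝ) ^ (-d 1)) atTop (𝓝 0) :=
    (tendsto_rpow_neg_atTop hd).comp tendsto_natCast_atTop_atTop
  have hz : (fun n : ℕ => Z * (n : ℝ) ^ (-d 1)) =O[atTop] fun n : ℕ => (n : ℝ) ^ (-d 1) :=
    isBigO_const_mul_self _ _ _
  have hstep : ∀ m : ℕ, 1 ≤ m → m + 1 ≤ k →
      (fun n : ℕ => x n - ∑ j ∈ Finset.Icc 1 m, expansionCoeff d j * (Z * (n : ℝ) ^ (-d 1)) ^ j)
        =o[atTop] (fun n : ℕ => ((n : ℝ) ^ (-d 1)) ^ m) →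
      (fun n : ℕ => R n - ∑ t ∈ Finset.Icc 2 (m + 1),
        d 1 * ((t : ℝ) - 1) * expansionCoeff d t * (Z * (n : ℝ) ^ (-d 1)) ^ t)
      =o[atTop] fun n : ℕ => ((n : ℝ) ^ (-d 1)) ^ (m + 1) := by
    intro m hm hmk hE
    obtain ⟨hxq, hS⟩ := sum_pow_expansion hd.ne' hq hz hm hE
    exact (((hR (m + 1) (by omega) hmk).trans_isBigO (hxq.pow (m + 1))).add hS).congr_left
      fun n => by ring
  suffices h : (fun n : ℕ =>
      x n - ∑ j ∈ Finset.Icc 1 m, expansionCoeff d j * (Z * (n : ℝ) ^ (-d 1)) ^ j)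
      =o[atTop] (fun n : ℕ => ((n : ℝ) ^ (-d 1)) ^ m) from ⟨h, fun hk => hstep m hm hk h⟩
  induction m, hm using Nat.le_induction with
  | base =>
    have h1 : (fun n : ℕ => (n : ℝ) ^ d 1 * x n - Z) =o[atTop] fun _ => (1 : ℝ) :=
      (isLittleO_one_iff ℝ).2 (by simpa using hZ.sub_const Z)
    have h2 := (isBigO_refl (fun n : ℕ => (n : ℝ) ^ (-d 1)) atTop).mul_isLittleO h1
    refine h2.congr' ?_ (Eventually.of_forall fun n => by simp)
    filter_upwards [eventually_gt_atTop 0] with n hn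
    have hn0 : (0 : ℝ) < n := by exact_mod_cast hn
    rw [mul_sub, ← mul_assoc, ← Real.rpow_add hn0]
    simp [expansionCoeff_one, mul_comm]
  | succ m hm ih =>
    push_cast at hmγ
    have hE := ih (by omega) (by nlinarith)
    obtain ⟨N, hN, hNo⟩ := hnoise m hm hmγ
    exact expansion_succ hd hx hN hm hmγ hNo (expansionCoeff_one d) hZ (hstep m hm hmk hE)

/-! ### Assembly along almost every path -/

theorem mainTheorem5 {Ω : Type*} {mΩ : MeasurableSpace Ω} (μ : Measure Ω) [IsProbabilityMeasure μ]
    (𝒯 : Filtration ℕ mΩ) (𝒟 : Set ℝ) (ψ : ℝ → ℝ) (Θ ε : ℕ → Ω → ℝ) (θ₀ : ℝ) (k : ℕ)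
    (hSA : IsStochasticApproximation μ 𝒯 𝒟 ψ (fun n => 1 / ((n : ℝ) + 1)) Θ ε)
    (hθ₀ : θ₀ ∈ 𝒟) (h𝒟 : ∃ U ∈ 𝓝 θ₀, (𝒟 ∩ U).OrdConnected)
    (hzero : ψ θ₀ = 0)
    (hlim : ∀ᵐ ω ∂μ, Tendsto (fun n => Θ n ω) atTop (𝓝 θ₀))
    (hpos : 0 < derivWithin ψ 𝒟 θ₀)
    (hnoise : IsRegularNoise μ 𝒯 ε)
    (hk : 1 ≤ k) (hdiff : TimesDifferentiableWithinAt k ψ 𝒟 θ₀)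
    (hone : k = 1 → ∃ δ : ℝ, 0 < δ ∧
      (fun θ => ψ θ - (ψ θ₀ + derivWithin ψ 𝒟 θ₀ * (θ - θ₀))) =o[𝓝[𝒟] θ₀]
        (fun θ => |θ - θ₀| ^ (1 + δ)))
    (hlt : derivWithin ψ 𝒟 θ₀ < 1 / 2) :
    ∃ Z : Ω → ℝ, Measurable Z ∧
      (∀ᵐ ω ∂μ, Tendsto (fun n : ℕ => (n : ℝ) ^ derivWithin ψ 𝒟 θ₀ * (Θ n ω - θ₀)) atTop
        (𝓝 (Z ω))) ∧
      (1 < k → derivWithin ψ 𝒟 θ₀ < 1 / (2 * ((k : ℝ) - 1)) →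
        ∀ᵐ ω ∂μ, ∀ r : ℕ → ℝ, (r =O[atTop] fun j => 1 / (j : ℝ)) →
          Summable (tailTerm ψ 𝒟 θ₀ r (fun j => Θ j ω)) ∧
          (fun n : ℕ => (n : ℝ) ^ (((k : ℝ) - 1) * derivWithin ψ 𝒟 θ₀) *
                tailSum ψ 𝒟 θ₀ r (fun j => Θ j ω) n -
              ∑ t ∈ Finset.Icc 2 k, (n : ℝ) ^ (((k : ℝ) - t) * derivWithin ψ 𝒟 θ₀) *
                expansionCoeff (fun i => iteratedDerivWithin i ψ 𝒟 θ₀) t * Z ω ^ t)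
            =o[atTop] (fun _ => (1 : ℝ))) ∧
      (derivWithin ψ 𝒟 θ₀ < 1 / (2 * (k : ℝ)) →
        ∀ᵐ ω ∂μ,
          (fun n : ℕ => Θ n ω - θ₀ -
              ∑ j ∈ Finset.Icc 1 k, expansionCoeff (fun i => iteratedDerivWithin i ψ 𝒟 θ₀) j *
                (Z ω / (n : ℝ) ^ derivWithin ψ 𝒟 θ₀) ^ j)
            =o[atTop] (fun n : ℕ => (n : ℝ) ^ (-((k : ℝ) * derivWithin ψ 𝒟 θ₀)))) := by
  set γ := derivWithin ψ 𝒟 θ₀ with hγdef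
  set d : ℕ → ℝ := fun i => iteratedDerivWithin i ψ 𝒟 θ₀ with hd
  have hd1 : d 1 = γ := by simp [hd, iteratedDerivWithin_one, hγdef]
  set x : ℕ → Ω → ℝ := fun n ω => Θ n ω - θ₀ with hxdef
  set R : ℕ → Ω → ℝ := fun n ω => linearRemainder ψ 𝒟 θ₀ (Θ n ω - θ₀) with hRdef
  have hrec : ∀ᵐ ω ∂μ, ∀ n : ℕ, 1 ≤ n → x (n + 1) ω
      = (1 - γ / (n + 1)) * x n ω - 1 / ((n : ℝ) + 1) * (R n ω + ε (n + 1) ω) := by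
    filter_upwards [hSA.recurrence] with ω hω n hn
    simp only [hxdef, hRdef, linearRemainder, hω n hn, add_sub_cancel, ← hγdef]
    ring
  have hwithin : ∀ᵐ ω ∂μ, Tendsto (fun n => Θ n ω) atTop (𝓝[𝒟] θ₀) := by
    filter_upwards [hlim, hSA.mem_domain] with ω h1 h2
    exact tendsto_nhdsWithin_iff.2 ⟨h1, eventually_atTop.2 ⟨1, h2⟩⟩
  have htail : ∀ ρ : ℝ, 0 < ρ → ρ < 1 / 2 - γ → ∀ᵐ ω ∂μ, ∃ N : ℕ → ℝ,
      (∀ n : ℕ, 1 ≤ n → N (n + 1) = N n - ((n : ℝ) + 1) ^ (γ - 1) * ε (n + 1) ω) ∧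
      N =o[atTop] fun n : ℕ => (n : ℝ) ^ (-ρ) := fun ρ h1 h2 => hnoise.exists_tail h1 h2
  have hexp : ∀ᵐ ω ∂μ, ∀ m, 1 ≤ m → m ≤ k →
      (fun n => R n ω - ∑ i ∈ Finset.Icc 2 m, d i / (Nat.factorial i : ℝ) * x n ω ^ i)
        =o[atTop] fun n => x n ω ^ m := by
    filter_upwards [hwithin] with ω hω m hm hmk
    exact linearRemainder_expansion hθ₀ h𝒟 hm (hdiff.of_le hmk) hzero hω
  -- For `k ≥ 2` the second-order Taylor expansion gives `δ = 1`; for `k = 1` the extra assumption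
  -- is what provides `δ`.
  have hRO : ∃ δ : ℝ, 0 < δ ∧ ∀ᵐ ω ∂μ,
      (fun n => R n ω) =O[atTop] fun n => |x n ω| ^ (1 + δ) := by
    rcases hk.eq_or_lt with hk1 | hk2
    · obtain ⟨δ, hδ, ho⟩ := hone hk1.symm
      refine ⟨δ, hδ, ?_⟩
      filter_upwards [hwithin] with ω hω
      refine (ho.isBigO.comp_tendsto hω).congr_left fun n => ?_
      simp [hRdef, linearRemainder, hzero, ← hγdef]
    · refine ⟨1, one_pos, ?_⟩
      filter_upwards [hexp] with ω hω
      have h1 := (hω 2 (by norm_num) hk2).isBigO.add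
        (isBigO_const_mul_self (d 2 / (Nat.factorial 2 : ℝ)) (fun n => x n ω ^ 2) atTop)
      refine h1.congr (fun n => by simp) fun n => ?_
      rw [one_add_one_eq_two, Real.rpow_two, sq_abs]
  have hconv : ∀ᵐ ω ∂μ, ∃ l, Tendsto (fun n : ℕ => (n : ℝ) ^ γ * (Θ n ω - θ₀)) atTop (𝓝 l) := by
    obtain ⟨δ, hδ, hO⟩ := hRO
    filter_upwards [hrec, hlim, hO, htail ((1 / 2 - γ) / 2) (by linarith) (by linarith)]
      with ω h1 h2 h3 ⟨N, hN, hNo⟩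
    have hN0 : Tendsto N atTop (𝓝 0) := hNo.trans_tendsto
      ((tendsto_rpow_neg_atTop (by linarith)).comp tendsto_natCast_atTop_atTop)
    have hx0 : Tendsto (fun n => x n ω) atTop (𝓝 0) := by simpa using h2.sub_const θ₀
    exact exists_tendsto_rescaled (ε := fun n => ε n ω) hpos (by linarith) h1 hN hN0 hx0 hδ h3
  obtain ⟨Z, hZm, hZ⟩ := measurable_limit_of_tendsto_metrizable_ae (fun n => by
    -- Adaptedness starts at index 1; at index 0 the factor `0 ^ γ = 0` makes the function constant.
    rcases Nat.eq_zero_or_pos n with rfl | hn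
    · simp [Real.zero_rpow hpos.ne']
    · exact ((((hSA.adapted n hn).mono (𝒯.le n) le_rfl).sub_const θ₀).const_mul _).aemeasurable)
    hconv
  have htails : ∀ᵐ ω ∂μ, ∀ m : ℕ, 1 ≤ m → ((m : ℝ) + 1) * γ < 1 / 2 → ∃ N : ℕ → ℝ,
      (∀ n : ℕ, 1 ≤ n → N (n + 1) = N n - ((n : ℝ) + 1) ^ (γ - 1) * ε (n + 1) ω) ∧
      N =o[atTop] fun n : ℕ => (n : ℝ) ^ (-(m * γ)) := by
    -- The exceptional null sets are indexed by `m`, hence countably many.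
    refine ae_all_iff.2 fun m => ?_
    by_cases h : 1 ≤ m ∧ ((m : ℝ) + 1) * γ < 1 / 2
    · have hm : (0 : ℝ) < m := by exact_mod_cast h.1
      filter_upwards [htail (m * γ) (mul_pos hm hpos) (by linarith [h.2])] with ω hω _ _
      exact hω
    · exact Eventually.of_forall fun ω h1 h2 => absurd ⟨h1, h2⟩ h
  have hmain : ∀ᵐ ω ∂μ, ∀ m : ℕ, 1 ≤ m → m ≤ k → m * γ < 1 / 2 →
      (fun n : ℕ => x n ω - ∑ j ∈ Finset.Icc 1 m, expansionCoeff d j * (Z ω * (n : ℝ) ^ (-γ)) ^ j)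
        =o[atTop] (fun n : ℕ => ((n : ℝ) ^ (-γ)) ^ m) ∧
      (m + 1 ≤ k → (fun n : ℕ => R n ω - ∑ t ∈ Finset.Icc 2 (m + 1),
          γ * ((t : ℝ) - 1) * expansionCoeff d t * (Z ω * (n : ℝ) ^ (-γ)) ^ t)
        =o[atTop] fun n : ℕ => ((n : ℝ) ^ (-γ)) ^ (m + 1)) := by
    filter_upwards [hrec, hexp, htails, hZ] with ω h1 h2 h3 h4 m hm hmk hmγ
    have hd0 : 0 < d 1 := hd1 ▸ hpos
    rw [← hd1] at h1 h3 h4 hmγ ⊢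
    exact expansion_of_recursion (ε := fun n => ε n ω) hd0 h1 h2 h3 h4 hm hmk hmγ
  refine ⟨Z, hZm, hZ, fun hk1 hγk => ?_, fun hγk => ?_⟩
  · have hk1' : (0 : ℝ) < (k : ℝ) - 1 := by
      have : (1 : ℝ) < k := by exact_mod_cast hk1
      linarith
    have hkγ : ((k : ℝ) - 1) * γ < 1 / 2 := by
      rw [lt_div_iff₀ (by linarith)] at hγk
      linarith
    filter_upwards [hmain] with ω hω r hr
    -- The path is fixed before `r`, so one null set serves all `r`. Order `m = k - 1` for `x` gives
    -- order `k` for `R`.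
    obtain ⟨m, rfl⟩ := Nat.exists_eq_add_of_le' hk
    have hF := (hω m (by omega) (by omega) (by push_cast at hkγ; linarith)).2 le_rfl
    exact tsum_tail_expansion hpos (by omega) hkγ hr hF
  · have hk0 : (0 : ℝ) < k := by exact_mod_cast hk
    have hkγ : (k : ℝ) * γ < 1 / 2 := by
      rw [lt_div_iff₀ (by linarith)] at hγk
      linarith
    filter_upwards [hmain] with ω hω
    refine (hω k hk le_rfl hkγ).1.congr (fun n => ?_) fun n => ?_
    · simp only [hxdef, Real.rpow_neg (Nat.cast_nonneg n), div_eq_mul_inv]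
    · rw [← Real.rpow_mul_natCast (by positivity)]
      congr 1
      ring
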